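/- **Setting.** Let $P,X,Y,E$ be finite-dimensional real normed spaces, $Z:=P\times X$, and denote dual spaces by ${}^*$. Let $g\colon Z\to Y$, let $C\subset Y$ be closed, $\Gamma(p):=\{x\in X\mid g(p,x)\in C\}$, and $\bar z=(\bar p,\bar x)$ with $g(\bar z)\in C$. For a set $\Omega$ and $z\in\Omega$ let $T_\Omega(z)$ be the contingent (Bouligand) tangent cone, i.e. the set of all $w$ for which there are $t_k\downarrow 0$ and $w_k\to w$ with $z+t_kw_k\in\Omega$. Let $N_\Omega(z)$ be the limiting (Mordukhovich) normal cone, i.e. the set of limits of regular (Fréchet) normals to $\Omega$ at points of $\Omega$ converging to $z$; $N_\Omega(z):=\emptyset$ if $z\notin\Omega$. Let $\mathcal K_\Omega(z,z^*):=T_\Omega(z)\cap\{z^*\}^\perp$ be the critical cone and $\operatorname{lin}K:=K\cap(-K)$. Put $\Psi(p,x):=N_{\Gamma(p)}(x)$, fix $\bar x^*\in\Psi(\bar p,\bar x)$, and let $D\Psi(\bar p,\bar x,\bar x^*)(v):=\{u^*\mid (v,u^*)\in T_{\operatorname{gph}\Psi}(\bar p,\bar x,\bar x^*)\}$ be the graphical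 derivative. Let $\pi_{X^*}\colon P^*\times X^*\to X^*$ be the projection. Assume that: 1. $g$ is $C^2$-smooth around $\bar z$; 2. $C$ is $C^2$-reducible at $g(\bar z)$ to a closed convex cone $K\subset E$, i.e. there are an open neighborhood $V$ of $g(\bar z)$ and a $C^2$-mapping $h\colon V\to E$ such that $h(g(\bar z))=0$, $\nabla h(g(\bar z))$ is surjective, and $C\cap V=\{y\in V\mid h(y)\in K\}$; 3. (Robinson stability) there are $\kappa\ge0$ and neighborhoods $W$ of $\bar p$ and $U$ of $\bar x$ with $\operatorname{dist}(x;\Gamma(p))\le\kappa\operatorname{dist}(g(p,x);C)$ for all $(p,x)\in W\times U$, where $\operatorname{dist}(x;\emptyset)=\infty$; 4. (strict complementarity) there is $\mu\in\operatorname{ri}N_C(g(\bar z))$ with $\bar x^*=\nabla_xg(\bar z)^*\mu$. Define $$\mathcal P:=\{q\in P\mid \nabla_pg(\bar z)q\in\operatorname{rge}\nabla_xg(\bar z)+\operatorname{lin}T_C(g(\bar z))\},$$ $$\Lambda(\bar z,z^*):=\{\lambda\in N_C(g(\bar z))\mid\nabla g(\bar z)^*\lambda=z^*\},$$ $$\mathcal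 H_\lambda v:=\nabla_xg(\bar z)^*\,\nabla^2\big\langle(\nabla h(g(\bar z))^*)^{-1}\lambda,h(\cdot)\big\rangle(g(\bar z))\,\nabla g(\bar z)v .$$ **Theorem.** For every $v=(q,u)\in\mathcal P\times X$, $$D\Psi(\bar p,\bar x,\bar x^*)(v)\subset\Big\{\big(\nabla(\nabla_xg(\cdot)^*\hat\lambda)(\bar z)+\mathcal H_{\hat\lambda}\big)v+\pi_{X^*}(w^*)\ \Big|\ z^*\in N_{T_{\operatorname{gph}\Gamma}(\bar z)}(v),\ \pi_{X^*}(z^*)=\bar x^*,\ \hat\lambda\in\Lambda(\bar z,z^*),\ w^*\in N_{\mathcal K_{\operatorname{gph}\Gamma}(\bar z,z^*)}(v)\Big\}.$$ The inclusion holds as an equality for such $v$ if in addition $$\nabla h(g(\bar z))\nabla^2g(\bar z)(v,v)+\nabla^2h(g(\bar z))(\nabla g(\bar z)v,\nabla g(\bar z)v)\in\operatorname{rge}\big(\nabla h(g(\bar z))\circ\nabla g(\bar z)\big)+\operatorname{lin}K .$$ If $\nabla g(\bar z)$ is surjective, then this last condition is satisfied for every $v\in Z$. -/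

import Mathlib

open Filter Topology Set
open scoped Pointwise NNReal ENNReal

/-! ### Tangents and normals to sets -/

/-- The tangent (contingent, Bouligand-Severi) cone to `Ω` at `z`: all limits `w` of sequences
`w k` such that `z + t k • w k ∈ Ω` for some `t k ↓ 0`. -/
def contingentCone {Z : Type*} [NormedAddCommGroup Z] [NormedSpace ℝ Z]
    (Ω : Set Z) (z : Z) : Set Z :=
  {w | ∃ (t : ℕ → ℝ) (w' : ℕ → Z), (∀ k, 0 < t k) ∧ Tendsto t atTop (𝓝 0) ∧
    Tendsto w' atTop (𝓝 w) ∧ ∀ k, z + t k • w' k ∈ Ω}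

/-- The regular (Fréchet) normal cone to `Ω` at `z`, which is empty if `z ∉ Ω`:
the upper limit of `⟨z*, z' - z⟩ / ‖z' - z‖` as `z' → z` within `Ω` is nonpositive. -/
def regularNormalCone {Z : Type*} [NormedAddCommGroup Z] [NormedSpace ℝ Z]
    (Ω : Set Z) (z : Z) : Set (StrongDual ℝ Z) :=
  {zs | z ∈ Ω ∧ ∀ ε : ℝ, 0 < ε → ∀ᶠ z' in 𝓝[Ω] z, zs (z' - z) ≤ ε * ‖z' - z‖}

/-- The limiting (Mordukhovich) normal cone to `Ω` at `z`, which is empty if `z ∉ Ω`. -/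
def limitingNormalCone {Z : Type*} [NormedAddCommGroup Z] [NormedSpace ℝ Z]
    (Ω : Set Z) (z : Z) : Set (StrongDual ℝ Z) :=
  {zs | z ∈ Ω ∧ ∃ (z' : ℕ → Z) (zs' : ℕ → StrongDual ℝ Z),
    (∀ k, z' k ∈ Ω) ∧ Tendsto z' atTop (𝓝 z) ∧
    (∀ k, zs' k ∈ regularNormalCone Ω (z' k)) ∧ Tendsto zs' atTop (𝓝 zs)}

/-- The critical cone `T_Ω(z) ∩ {z*}^⊥`. -/
def criticalCone {Z : Type*} [NormedAddCommGroup Z] [NormedSpace ℝ Z]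
    (Ω : Set Z) (z : Z) (zs : StrongDual ℝ Z) : Set Z :=
  contingentCone Ω z ∩ {w | zs w = 0}

/-- The lineality space `K ∩ (-K)` of a closed convex cone `K`. -/
def linealitySpace {F : Type*} [AddCommGroup F] (K : Set F) : Set F :=
  K ∩ -K

/-! ### Set-valued mappings -/

/-- The graph of a set-valued mapping. -/
def graphOf {Z U : Type*} (F : Z → Set U) : Set (Z × U) :=
  {w | w.2 ∈ F w.1}

/-- The graphical derivative of `F` at the point `(z, u)` of its graph. -/
def graphicalDerivative {Z U : Type*} [NormedAddCommGroup Z] [NormedSpace ℝ Z]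
    [NormedAddCommGroup U] [NormedSpace ℝ U] (F : Z → Set U) (z : Z) (u : U) (w : Z) : Set U :=
  {v | (w, v) ∈ contingentCone (graphOf F) (z, u)}

/-! ### Cone reducibility and strict complementarity -/

/-- The set `C` is `C²`-reducible at `y` to the closed convex cone `K` by the mapping `h`, defined
and twice continuously differentiable on the open neighborhood `V` of `y`. -/
structure IsC2Reduction {Y E : Type*} [NormedAddCommGroup Y] [NormedSpace ℝ Y]
    [NormedAddCommGroup E] [NormedSpace ℝ E] (C : Set Y) (y : Y) (K : ProperCone ℝ E)
    (V : Set Y) (h : Y → E) : Prop where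
  isOpen : IsOpen V
  mem : y ∈ V
  contDiffOn : ContDiffOn ℝ 2 h V
  map_eq_zero : h y = 0
  surjective : Function.Surjective (fderiv ℝ h y)
  inter_eq : C ∩ V = {y' | y' ∈ V ∧ h y' ∈ K}

/-- Strict complementarity for the system `f(z) ∈ C` at `(z, z*)`, where `f z ∈ C` and `z*` is
normal to `f⁻¹(C)` at `z`. -/
def StrictComplementarity {Z Y : Type*} [NormedAddCommGroup Z] [NormedSpace ℝ Z]
    [NormedAddCommGroup Y] [NormedSpace ℝ Y] (f : Z → Y) (C : Set Y) (z : Z)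
    (zs : StrongDual ℝ Z) : Prop :=
  ∃ μ ∈ intrinsicInterior ℝ (limitingNormalCone C (f z)), zs = μ.comp (fderiv ℝ f z)

/-- The inverse `(A^*)⁻¹` of the adjoint `A^* : E^* → Y^*`, `μ ↦ μ ∘ A`, of a surjective linear
mapping `A`; it is meaningful on the range of `A^*`. -/
noncomputable def adjointInv {Y E : Type*} [NormedAddCommGroup Y] [NormedSpace ℝ Y]
    [NormedAddCommGroup E] [NormedSpace ℝ E] (A : Y →L[ℝ] E) (l : StrongDual ℝ Y) :
    StrongDual ℝ E :=
  Function.invFun (fun μ : StrongDual ℝ E => μ.comp A) l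

theorem adjointInv_comp {Y E : Type*} [NormedAddCommGroup Y] [NormedSpace ℝ Y]
    [NormedAddCommGroup E] [NormedSpace ℝ E] (A : Y →L[ℝ] E) (hA : Function.Surjective A)
    (μ : StrongDual ℝ E) : adjointInv A (μ.comp A) = μ := by
  have hinj : Function.Injective (fun μ : StrongDual ℝ E => μ.comp A) := by
    intro μ₁ μ₂ h12
    ext e
    obtain ⟨y, rfl⟩ := hA e
    exact DFunLike.congr_fun h12 y
  exact Function.leftInverse_invFun hinj μ

/-! ### Parametric constraint systems `g(p, x) ∈ C` -/

section ParametricSystem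

variable {P X Y E : Type*} [NormedAddCommGroup P] [NormedSpace ℝ P]
  [NormedAddCommGroup X] [NormedSpace ℝ X] [NormedAddCommGroup Y] [NormedSpace ℝ Y]
  [NormedAddCommGroup E] [NormedSpace ℝ E]

/-- The solution map `Γ(p) = {x | g(p, x) ∈ C}`. -/
def solutionMap (g : P × X → Y) (C : Set Y) (p : P) : Set X :=
  {x | g (p, x) ∈ C}

/-- The normal cone mapping `Ψ(p, x) = N_{Γ(p)}(x)`. -/
def normalConeMap (g : P × X → Y) (C : Set Y) (z : P × X) : Set (StrongDual ℝ X) :=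
  limitingNormalCone (solutionMap g C z.1) z.2

/-- Robinson stability of `g(p, x) ∈ C` at `(p₀, x₀)`. Distances take values in `[0, ∞]`, so that
the distance to the empty set is `∞`. -/
def RobinsonStable (g : P × X → Y) (C : Set Y) (p₀ : P) (x₀ : X) : Prop :=
  ∃ κ : ℝ≥0, ∃ W ∈ 𝓝 p₀, ∃ U ∈ 𝓝 x₀, ∀ p ∈ W, ∀ x ∈ U,
    Metric.infEDist x (solutionMap g C p) ≤ κ * Metric.infEDist (g (p, x)) C

/-- The partial derivative `∇ₚ g(z)`. -/
noncomputable def partialP (g : P × X → Y) (z : P × X) : P →L[ℝ] Y :=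
  fderiv ℝ (fun p => g (p, z.2)) z.1

/-- The partial derivative `∇ₓ g(z)`. -/
noncomputable def partialX (g : P × X → Y) (z : P × X) : X →L[ℝ] Y :=
  fderiv ℝ (fun x => g (z.1, x)) z.2

/-- The projection `π_{X^*}` of `(P × X)^* = P^* × X^*` onto `X^*`. -/
def projXDual (zs : StrongDual ℝ (P × X)) : StrongDual ℝ X :=
  zs.comp (ContinuousLinearMap.inr ℝ P X)

/-- The characteristic subspace of parameters `q` with `∇ₚ g(z) q ∈ rge ∇ₓ g(z) + lin T_C(g(z))`. -/
def characteristicSubspace (g : P × X → Y) (C : Set Y) (z : P × X) : Set P :=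
  {q | partialP g z q ∈ range (partialX g z) + linealitySpace (contingentCone C (g z))}

/-- The multiplier set `Λ(z, z*)` of all `λ ∈ N_C(g(z))` with `∇g(z)^* λ = z*`. -/
def multiplierSet (g : P × X → Y) (C : Set Y) (z : P × X) (zs : StrongDual ℝ (P × X)) :
    Set (StrongDual ℝ Y) :=
  {l | l ∈ limitingNormalCone C (g z) ∧ l.comp (fderiv ℝ g z) = zs}

/-- The derivative `∇(∇ₓ g(·)^* λ)(z) v`. -/
noncomputable def lagrangianTerm (g : P × X → Y) (z : P × X) (l : StrongDual ℝ Y) (v : P × X) :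
    StrongDual ℝ X :=
  fderiv ℝ (fun z' => l.comp (partialX g z')) z v

/-- The curvature term
`H_λ v = ∇ₓ g(z)^* ∇²⟨(∇h(g(z))^*)⁻¹ λ, h(·)⟩(g(z)) ∇g(z) v`. -/
noncomputable def curvatureTerm (g : P × X → Y) (h : Y → E) (z : P × X) (l : StrongDual ℝ Y)
    (v : P × X) : StrongDual ℝ X :=
  (fderiv ℝ (fderiv ℝ (fun y => adjointInv (fderiv ℝ h (g z)) l (h y))) (g z)
    (fderiv ℝ g z v)).comp (partialX g z)

/-- The set of all `∇(∇ₓ g(·)^* λ)(z) v + H_λ v + π_{X^*}(w*)` with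
`z* ∈ N_{T_{gph Γ}(z)}(v)`, `π_{X^*}(z*) = x*`, `λ ∈ Λ(z, z*)` and
`w* ∈ N_{K_{gph Γ}(z, z*)}(v)`. -/
def derivativeEstimate (g : P × X → Y) (C : Set Y) (h : Y → E) (z : P × X)
    (xs : StrongDual ℝ X) (v : P × X) : Set (StrongDual ℝ X) :=
  {us | ∃ zs ∈ limitingNormalCone (contingentCone (graphOf (solutionMap g C)) z) v,
    projXDual zs = xs ∧ ∃ l ∈ multiplierSet g C z zs,
      ∃ ws ∈ limitingNormalCone (criticalCone (graphOf (solutionMap g C)) z zs) v,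
        us = lagrangianTerm g z l v + curvatureTerm g h z l v + projXDual ws}

/-- The second-order condition
`∇h(g(z)) ∇²g(z)(v, v) + ∇²h(g(z))(∇g(z) v, ∇g(z) v) ∈ rge (∇h(g(z)) ∘ ∇g(z)) + lin K`. -/
def SecondOrderRangeCondition (g : P × X → Y) (h : Y → E) (K : ProperCone ℝ E) (z : P × X)
    (v : P × X) : Prop :=
  fderiv ℝ h (g z) (fderiv ℝ (fderiv ℝ g) z v v) +
      fderiv ℝ (fderiv ℝ h) (g z) (fderiv ℝ g z v) (fderiv ℝ g z v) ∈
    range ((fderiv ℝ h (g z)).comp (fderiv ℝ g z)) + linealitySpace (K : Set E)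

end ParametricSystem

/-! Put F = h ∘ g and A = ∇F(z̄), with partial map A_x. Since F(z̄) = 0, near z̄ the graph of Γ is
F⁻¹(K), and Robinson stability passes to the system F ∈ K (`IsC2Reduction.exists_isConeSystem`).
Hence the tangent cone of the graph is A⁻¹(K), N_C(g(z̄)) is the pullback by ∇h of the polar cone
K°, and for λ = η ∘ ∇h the Lagrangian and curvature terms add up to the X*-part of η ∘ ∇²F(z̄)v
(`lagrangianTerm_add_curvatureTerm`). Strict complementarity becomes a relative interior point η₀ of
K° with η₀ ∘ A_x = x̄*.

Inclusion. Normals along a sequence defining the graphical derivative have bounded multipliers η_n;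
let η be a limit point. Each η_n kills lin K, so dividing the multiplier equation by t_n shows that
u* - η ∘ ∇²F(z̄)v vanishes on {u | A(0,u) ∈ lin K} (`exists_multiplier_of_mem_graphicalDerivative`).
Such a functional is σ ∘ A_x with σ in the span of K°. Adding a large multiple of η₀ - η, which is
invisible to A_x, makes σ nonpositive on K ∩ η^⊥ (`exists_polar_extension`). Finally q ∈ 𝒫 together
with η₀ forces Av ∈ lin K (`map_mem_linealitySpace_of_critical`), so the resulting functional is
normal to the critical cone at v.

Equality. A normal w* to the critical cone vanishes along every (0,u) with A(0,u) ∈ lin K, so only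
functionals η ∘ ∇²F(z̄)v + s, with s vanishing on those u, have to be realized. The second-order
condition gives an arc z̄ + tv + t²w whose F-values lie within o(t²) of lin K. Polar functionals η_n
→ η with η_n ∘ A_x = x̄* + t_n s are turned into genuine normals by penalized minimization over
Γ(p_n); the minimizer is o(t_n) away from the arc (`add_mem_graphicalDerivative`). -/

/-! ### Joint limits of operators and arguments -/

section OperatorLimits

variable {ι E₁ E₂ E₃ : Type*} [NormedAddCommGroup E₁] [NormedSpace ℝ E₁]
  [NormedAddCommGroup E₂] [NormedSpace ℝ E₂] [NormedAddCommGroup E₃] [NormedSpace ℝ E₃]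
  {l : Filter ι}

theorem tendsto_clm_apply {f : ι → E₁ →L[ℝ] E₂} {f₀ : E₁ →L[ℝ] E₂} {e : ι → E₁} {e₀ : E₁}
    (hf : Tendsto f l (𝓝 f₀)) (he : Tendsto e l (𝓝 e₀)) :
    Tendsto (fun i => f i (e i)) l (𝓝 (f₀ e₀)) :=
  ((isBoundedBilinearMap_apply (𝕜 := ℝ) (E := E₁) (F := E₂)).continuous.tendsto (f₀, e₀)).comp
    (hf.prodMk_nhds he)

theorem tendsto_clm_comp {f : ι → E₂ →L[ℝ] E₃} {f₀ : E₂ →L[ℝ] E₃} {e : ι → E₁ →L[ℝ] E₂}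
    {e₀ : E₁ →L[ℝ] E₂} (hf : Tendsto f l (𝓝 f₀)) (he : Tendsto e l (𝓝 e₀)) :
    Tendsto (fun i => (f i).comp (e i)) l (𝓝 (f₀.comp e₀)) :=
  ((isBoundedBilinearMap_comp (𝕜 := ℝ) (E := E₁) (F := E₂) (G := E₃)).continuous.tendsto
    (f₀, e₀)).comp (hf.prodMk_nhds he)

end OperatorLimits

/-! ### Multipliers for normals to inverse images of convex cones -/

section Multipliers

variable {X E : Type*} [NormedAddCommGroup X] [NormedSpace ℝ X]
  [NormedAddCommGroup E] [NormedSpace ℝ E]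

/-- The polar cone of a closed convex cone, as a set of functionals. -/
def polarCone (K : ProperCone ℝ E) : Set (StrongDual ℝ E) :=
  {η | ∀ k ∈ K, η k ≤ 0}

/-- With `infDist_add_le_pointedCone` this makes the distance to a cone sublinear, hence usable as
the majorant in a Hahn–Banach extension. -/
theorem infDist_smul_pointedCone (D : PointedCone ℝ E) {a : ℝ} (ha : 0 < a) (e : E) :
    Metric.infDist (a • e) (D : Set E) = a * Metric.infDist e D := by
  have key : ∀ {b : ℝ}, 0 < b → ∀ e : E,
      Metric.infDist (b • e) (D : Set E) ≤ b * Metric.infDist e D := by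
    intro b hb e
    rw [← div_le_iff₀' hb]
    refine (Metric.le_infDist ⟨0, D.zero_mem⟩).2 fun {d} hd => ?_
    rw [div_le_iff₀' hb]
    have : (⟨b, hb.le⟩ : ℝ≥0) • d ∈ D := D.smul_mem hb.le hd
    refine (Metric.infDist_le_dist_of_mem this).trans ?_
    have h2 : (⟨b, hb.le⟩ : ℝ≥0) • d = b • d := rfl
    rw [h2, dist_smul₀, Real.norm_of_nonneg hb.le]
  refine le_antisymm (key ha e) ?_
  have := key (inv_pos.2 ha) (a • e)
  rw [smul_smul, inv_mul_cancel₀ ha.ne', one_smul] at this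
  rwa [← div_eq_inv_mul, le_div_iff₀' ha] at this

theorem infDist_add_le_pointedCone (D : PointedCone ℝ E) (e₁ e₂ : E) :
    Metric.infDist (e₁ + e₂) (D : Set E) ≤ Metric.infDist e₁ D + Metric.infDist e₂ D := by
  refine le_of_forall_pos_lt_add fun ε hε => ?_
  have hne : (D : Set E).Nonempty := ⟨0, D.zero_mem⟩
  obtain ⟨d₁, hd₁, h₁⟩ := (Metric.infDist_lt_iff hne).1
    (lt_add_of_pos_right (Metric.infDist e₁ (D : Set E)) (half_pos hε))
  obtain ⟨d₂, hd₂, h₂⟩ := (Metric.infDist_lt_iff hne).1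
    (lt_add_of_pos_right (Metric.infDist e₂ (D : Set E)) (half_pos hε))
  have h := Metric.infDist_le_dist_of_mem (x := e₁ + e₂) (D.add_mem hd₁ hd₂)
  have h' := dist_add_add_le e₁ e₂ d₁ d₂
  linarith

/-- A functional dominated by the distance to a convex cone along a linear mapping factors through
this mapping, the factor being polar to the cone and equally bounded. -/
theorem exists_multiplier_of_le_dist (D : PointedCone ℝ E) (A : X →L[ℝ] E)
    (xs : StrongDual ℝ X) {c : ℝ} (hc : 0 ≤ c)
    (hle : ∀ u, ∀ d ∈ D, xs u ≤ c * ‖A u - d‖) :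
    ∃ η : StrongDual ℝ E, (∀ d ∈ D, η d ≤ 0) ∧ η.comp A = xs ∧ ‖η‖ ≤ c := by
  have hne : (D : Set E).Nonempty := ⟨0, D.zero_mem⟩
  have hdist : ∀ u, xs u ≤ c * Metric.infDist (A u) D := by
    intro u
    rcases hc.eq_or_lt with rfl | hc'
    · simpa using hle u 0 D.zero_mem
    rw [← div_le_iff₀' hc']
    refine (Metric.le_infDist hne).2 fun {d} hd => ?_
    rw [div_le_iff₀' hc', dist_eq_norm]
    exact hle u d hd
  have hker : A.toLinearMap.ker ≤ xs.toLinearMap.ker := by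
    intro u hu
    have hu' : A u = 0 := hu
    have h1 := hle u 0 D.zero_mem
    have h2 := hle (-u) 0 D.zero_mem
    simp only [map_neg, hu', sub_zero, neg_zero, norm_zero, mul_zero] at h1 h2
    exact le_antisymm h1 (neg_nonpos.1 h2)
  obtain ⟨f, hf⟩ : ∃ f : E →ₗ[ℝ] ℝ, f ∘ₗ A.toLinearMap = xs.toLinearMap := by
    have : xs.toLinearMap ∈ A.toLinearMap.ker.dualAnnihilator :=
      (Submodule.mem_dualAnnihilator _).2 fun u hu => hker hu
    rw [← LinearMap.range_dualMap_eq_dualAnnihilator_ker] at this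
    exact this
  have hfA : ∀ u, f (A u) = xs u := fun u => LinearMap.congr_fun hf u
  -- Domination by `c * infDist · D` gives two things at once: polarity, because the majorant
  -- vanishes on `D`, and the norm bound, because `0 ∈ D`.
  obtain ⟨φ, hφ, hφle⟩ := exists_extension_of_le_sublinear
    (⟨A.toLinearMap.range, f.domRestrict _⟩ : E →ₗ.[ℝ] ℝ) (fun e => c * Metric.infDist e D)
    (fun a ha e => by
      show c * Metric.infDist (a • e) _ = _
      rw [infDist_smul_pointedCone D ha]; ring)
    (fun e₁ e₂ => by
      rw [← mul_add]
      exact mul_le_mul_of_nonneg_left (infDist_add_le_pointedCone D e₁ e₂) hc)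
    (by
      rintro ⟨e, u, rfl⟩
      exact (hfA u).le.trans (hdist u))
  have hbound : ∀ e, φ e ≤ c * ‖e‖ := fun e => by
    refine (hφle e).trans (mul_le_mul_of_nonneg_left ?_ hc)
    simpa using Metric.infDist_le_dist_of_mem (x := e) D.zero_mem
  have hnorm : ∀ e, ‖φ e‖ ≤ c * ‖e‖ := fun e => by
    rw [Real.norm_eq_abs, abs_le]
    have h := hbound (-e)
    rw [map_neg, norm_neg] at h
    exact ⟨by linarith, hbound e⟩
  refine ⟨φ.mkContinuous c hnorm, fun d hd => ?_, ?_, φ.mkContinuous_norm_le hc hnorm⟩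
  · have h := hφle d
    rwa [Metric.infDist_zero_of_mem hd, mul_zero] at h
  · ext u
    exact (hφ ⟨A u, u, rfl⟩).trans (hfA u)

/-- The multiplier rule for regular normals under metric subregularity. -/
theorem exists_multiplier_of_mem_regularNormalCone {Γ : Set X} {G : X → E} {A : X →L[ℝ] E} {x : X}
    {K : ProperCone ℝ E} {κ : ℝ} (hκ : 0 ≤ κ) (hG : HasFDerivAt G A x) (hGx : G x ∈ K)
    (hR : ∀ᶠ x' in 𝓝 x, ∀ k ∈ K, ∃ x'' ∈ Γ, ‖x'' - x'‖ ≤ κ * ‖G x' - k‖)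
    {xs : StrongDual ℝ X} (hxs : xs ∈ regularNormalCone Γ x) :
    ∃ η ∈ polarCone K, η (G x) = 0 ∧ η.comp A = xs ∧ ‖η‖ ≤ κ * ‖xs‖ := by
  -- Enlarging `K` by the ray of `-G x` is what yields `η (G x) = 0`. It is admissible because G x +
  -- t(k - r G x) = (1 - tr) G x + t k stays in `K` for small t.
  have key : ∀ u, ∀ k ∈ K, ∀ r : ℝ, 0 ≤ r →
      xs u ≤ κ * ‖xs‖ * ‖A u - (k - r • G x)‖ := by
    intro u k hk r hr
    set t : ℕ → ℝ := fun n => 1 / ((n : ℝ) + 1) with ht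
    have ht0 : ∀ n, 0 < t n := fun n => Nat.one_div_pos_of_nat
    have htl : Tendsto t atTop (𝓝 0) := tendsto_one_div_add_atTop_nhds_zero_nat
    have htu : Tendsto (fun n => t n • u) atTop (𝓝 0) := by
      simpa using htl.smul_const u
    have hxl : Tendsto (fun n => x + t n • u) atTop (𝓝 x) := by
      simpa using tendsto_const_nhds.add htu
    have hlim : Tendsto (fun n => (t n)⁻¹ • (G (x + t n • u) - G x)) atTop (𝓝 (A u)) := by
      refine (hasFDerivWithinAt_univ.2 hG).lim htu (.of_forall fun _ => mem_univ _) ?_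
      refine tendsto_const_nhds.congr fun n => ?_
      rw [smul_smul, inv_mul_cancel₀ (ht0 n).ne', one_smul]
    set q : ℕ → E := fun n => (t n)⁻¹ • (G (x + t n • u) - G x) - (k - r • G x) with hq
    have hql : Tendsto q atTop (𝓝 (A u - (k - r • G x))) := hlim.sub_const _
    have hev : ∀ᶠ n in atTop, ∃ x'' ∈ Γ, ‖x'' - (x + t n • u)‖ ≤ t n * (κ * ‖q n‖) := by
      have h1 : ∀ᶠ n in atTop, 0 < 1 - t n * r := by
        have : Tendsto (fun n => 1 - t n * r) atTop (𝓝 1) := by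
          simpa using (htl.mul_const r).const_sub 1
        exact this.eventually_const_lt one_pos
      filter_upwards [hxl.eventually hR, h1] with n hn hn1
      have hmem : (1 - t n * r) • G x + t n • k ∈ K :=
        K.add_mem (K.smul_mem hGx hn1.le) (K.smul_mem hk (ht0 n).le)
      obtain ⟨x'', hx'', hle⟩ := hn _ hmem
      refine ⟨x'', hx'', hle.trans_eq ?_⟩
      have : G (x + t n • u) - ((1 - t n * r) • G x + t n • k) = t n • q n := by
        simp only [hq, smul_sub, smul_smul, mul_inv_cancel₀ (ht0 n).ne', one_smul, sub_smul]
        abel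
      rw [this, norm_smul, Real.norm_of_nonneg (ht0 n).le]
      ring
    have hbd : ∀ ε : ℝ, 0 < ε → ∀ᶠ n in atTop,
        xs u ≤ ε * (κ * ‖q n‖ + ‖u‖) + ‖xs‖ * (κ * ‖q n‖) := by
      intro ε hε
      have hbdd : Tendsto (fun n => t n * (κ * ‖q n‖ + ‖u‖)) atTop (𝓝 0) := by
        simpa using htl.mul (((hql.norm).const_mul κ).add_const ‖u‖)
      obtain ⟨δ, hδ, hball⟩ := Metric.mem_nhdsWithin_iff.1 (hxs.2 ε hε)
      filter_upwards [hev, hbdd.eventually_lt_const hδ] with n hn hn2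
      obtain ⟨x'', hx'', hle⟩ := hn
      have h3 : ‖x'' - x‖ ≤ t n * (κ * ‖q n‖ + ‖u‖) := by
        have : x'' - x = (x'' - (x + t n • u)) + t n • u := by abel
        rw [this]
        refine (norm_add_le _ _).trans ?_
        rw [norm_smul, Real.norm_of_nonneg (ht0 n).le, mul_add]
        linarith
      have h4 : xs (x'' - x) ≤ ε * ‖x'' - x‖ :=
        hball ⟨by rw [Metric.mem_ball, dist_eq_norm]; exact h3.trans_lt hn2, hx''⟩
      have h5 : xs (t n • u) = xs (x'' - x) - xs (x'' - (x + t n • u)) := by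
        rw [← map_sub]; congr 1; abel
      have h6 : -xs (x'' - (x + t n • u)) ≤ ‖xs‖ * (t n * (κ * ‖q n‖)) :=
        (neg_le_abs _).trans ((xs.le_opNorm _).trans
          (mul_le_mul_of_nonneg_left hle (norm_nonneg _)))
      have h7 : ε * ‖x'' - x‖ ≤ ε * (t n * (κ * ‖q n‖ + ‖u‖)) :=
        mul_le_mul_of_nonneg_left h3 hε.le
      rw [map_smul, smul_eq_mul] at h5
      refine le_of_mul_le_mul_left ?_ (ht0 n)
      rw [h5]
      linarith
    have hbd2 : ∀ ε : ℝ, 0 < ε → xs u ≤ ε * (κ * ‖A u - (k - r • G x)‖ + ‖u‖) +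
        ‖xs‖ * (κ * ‖A u - (k - r • G x)‖) := fun ε hε =>
      ge_of_tendsto (((((hql.norm).const_mul κ).add_const ‖u‖).const_mul ε).add
        (((hql.norm).const_mul κ).const_mul ‖xs‖)) (hbd ε hε)
    have hcont : Tendsto (fun ε : ℝ => ε * (κ * ‖A u - (k - r • G x)‖ + ‖u‖) +
        ‖xs‖ * (κ * ‖A u - (k - r • G x)‖)) (𝓝[>] 0)
        (𝓝 (0 * (κ * ‖A u - (k - r • G x)‖ + ‖u‖) + ‖xs‖ * (κ * ‖A u - (k - r • G x)‖))) :=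
      ((tendsto_id.mul_const _).add_const _).mono_left nhdsWithin_le_nhds
    have := ge_of_tendsto hcont (eventually_mem_nhdsWithin.mono fun ε hε => hbd2 ε hε)
    linarith
  obtain ⟨η, hη, hηA, hηn⟩ := exists_multiplier_of_le_dist
    ((K : PointedCone ℝ E) ⊔ PointedCone.hull ℝ {-G x}) A xs (mul_nonneg hκ (norm_nonneg xs)) (by
      intro u d hd
      obtain ⟨k, hk, d', hd', rfl⟩ := Submodule.mem_sup.1 hd
      obtain ⟨r, rfl⟩ := Submodule.mem_span_singleton.1 hd'
      have := key u k hk r r.2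
      have h2 : k - (r : ℝ) • G x = k + r • (-G x) := by
        rw [smul_neg, ← sub_eq_add_neg]; rfl
      rwa [h2] at this)
  refine ⟨η, fun k hk => hη k (Submodule.mem_sup_left hk), ?_, hηA, hηn⟩
  refine le_antisymm (hη _ (Submodule.mem_sup_left hGx)) ?_
  have := hη (-G x) (Submodule.mem_sup_right (Submodule.mem_span_singleton_self _))
  rw [map_neg] at this
  linarith

/-- The multiplier rule for limiting normals under metric subregularity around the point. -/
theorem exists_multiplier_of_mem_limitingNormalCone [FiniteDimensional ℝ E] {Γ : Set X} {G : X → E}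
    {x : X} {K : ProperCone ℝ E} {κ : ℝ} (hκ : 0 ≤ κ) (hG : ContDiffAt ℝ 1 G x)
    (hmem : ∀ᶠ x' in 𝓝 x, x' ∈ Γ → G x' ∈ K)
    (hR : ∀ᶠ x' in 𝓝 x, ∀ k ∈ K, ∃ x'' ∈ Γ, ‖x'' - x'‖ ≤ κ * ‖G x' - k‖)
    {xs : StrongDual ℝ X} (hxs : xs ∈ limitingNormalCone Γ x) :
    ∃ η ∈ polarCone K, η (G x) = 0 ∧ η.comp (fderiv ℝ G x) = xs ∧ ‖η‖ ≤ κ * ‖xs‖ := by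
  obtain ⟨-, x', xs', hx', hxl, hreg, hxsl⟩ := hxs
  have hd : ∀ᶠ x' in 𝓝 x, HasFDerivAt G (fderiv ℝ G x') x' :=
    (hG.eventually (by simp)).mono fun y hy => (hy.differentiableAt (by simp)).hasFDerivAt
  have hev : ∀ᶠ n in atTop, ∃ η ∈ polarCone K, η (G (x' n)) = 0 ∧
      η.comp (fderiv ℝ G (x' n)) = xs' n ∧ ‖η‖ ≤ κ * ‖xs' n‖ := by
    filter_upwards [hxl.eventually hmem, hxl.eventually hd, hxl.eventually hR.eventually_nhds]
      with n h1 h2 h3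
    exact exists_multiplier_of_mem_regularNormalCone hκ h2 (h1 (hx' n)) h3 (hreg n)
  obtain ⟨N, hN⟩ := eventually_atTop.1 hev
  choose η hηK hη0 hηA hηn using fun n => hN (n + N) (Nat.le_add_left N n)
  have hshift : Tendsto (fun n : ℕ => n + N) atTop atTop := tendsto_add_atTop_nat N
  have hxsl' := hxsl.comp hshift
  have hxl' := hxl.comp hshift
  obtain ⟨M, hM⟩ := hxsl'.norm.bddAbove_range
  -- The quantitative bound on the multipliers supplies the compactness needed to pass to the limit.
  have hbdd : ∀ n, η n ∈ Metric.closedBall (0 : StrongDual ℝ E) (κ * M) := fun n => by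
    rw [mem_closedBall_zero_iff]
    exact (hηn n).trans (mul_le_mul_of_nonneg_left (hM ⟨n, rfl⟩) hκ)
  obtain ⟨η₀, -, φ, hφ, hlim⟩ := tendsto_subseq_of_bounded Metric.isBounded_closedBall hbdd
  have hxsl'' := hxsl'.comp hφ.tendsto_atTop
  have hxl'' := hxl'.comp hφ.tendsto_atTop
  refine ⟨η₀, fun k hk => ?_, ?_, ?_, ?_⟩
  · exact le_of_tendsto' (tendsto_clm_apply hlim tendsto_const_nhds) fun n => hηK _ k hk
  · refine tendsto_nhds_unique (tendsto_clm_apply hlim (hG.continuousAt.tendsto.comp hxl'')) ?_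
    exact tendsto_const_nhds.congr fun n => (hη0 _).symm
  · have hfd : Tendsto (fderiv ℝ G) (𝓝 x) (𝓝 (fderiv ℝ G x)) :=
      (hG.fderiv_right (m := 0) (by simp)).continuousAt.tendsto
    refine tendsto_nhds_unique (tendsto_clm_comp hlim (hfd.comp hxl'')) ?_
    exact hxsl''.congr fun n => (hηA _).symm
  · exact le_of_tendsto_of_tendsto' hlim.norm (hxsl''.norm.const_mul κ) fun n => hηn _

end Multipliers

/-! ### Polar cones, lineality spaces and relative interiors -/

section Cones

variable {X Y E : Type*} [NormedAddCommGroup X] [NormedSpace ℝ X]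
  [NormedAddCommGroup Y] [NormedSpace ℝ Y] [NormedAddCommGroup E] [NormedSpace ℝ E]
  {K : ProperCone ℝ E}

/-- Bipolar theorem: a functional separating `e` from `K` is, up to sign, polar. -/
theorem mem_of_forall_polarCone {e : E} (h : ∀ η ∈ polarCone K, η e ≤ 0) : e ∈ K := by
  by_contra he
  obtain ⟨f, hf, hfe⟩ := K.hyperplane_separation_point he
  have := h (-f) fun k hk => neg_nonpos.2 (hf k hk)
  rw [_root_.neg_apply] at this
  linarith

theorem mem_linealitySpace {e : E} : e ∈ linealitySpace (K : Set E) ↔ e ∈ K ∧ -e ∈ K := by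
  simp [linealitySpace]

theorem apply_eq_zero_of_mem_linealitySpace {η : StrongDual ℝ E} (hη : η ∈ polarCone K) {e : E}
    (he : e ∈ linealitySpace (K : Set E)) : η e = 0 := by
  obtain ⟨h1, h2⟩ := mem_linealitySpace.1 he
  refine le_antisymm (hη e h1) ?_
  have := hη _ h2
  rwa [map_neg, neg_nonpos] at this

theorem linealitySpace_add {e₁ e₂ : E} (h₁ : e₁ ∈ linealitySpace (K : Set E))
    (h₂ : e₂ ∈ linealitySpace (K : Set E)) : e₁ + e₂ ∈ linealitySpace (K : Set E) := by
  rw [mem_linealitySpace] at *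
  refine ⟨K.add_mem h₁.1 h₂.1, ?_⟩
  rw [neg_add]
  exact K.add_mem h₁.2 h₂.2

theorem linealitySpace_smul (a : ℝ) {e : E} (h : e ∈ linealitySpace (K : Set E)) :
    a • e ∈ linealitySpace (K : Set E) := by
  rw [mem_linealitySpace] at *
  rcases le_total 0 a with ha | ha
  · exact ⟨K.smul_mem h.1 ha, by rw [← smul_neg]; exact K.smul_mem h.2 ha⟩
  · have ha' : 0 ≤ -a := neg_nonneg.2 ha
    exact ⟨by rw [← neg_smul_neg]; exact K.smul_mem h.2 ha',
      by rw [← neg_smul]; exact K.smul_mem h.1 ha'⟩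

theorem eventually_add_smul_mem_of_mem_intrinsicInterior {s : Set X} {x d : X}
    (hx : x ∈ intrinsicInterior ℝ s) (hd : d ∈ vectorSpan ℝ s) :
    ∀ᶠ τ : ℝ in 𝓝 0, x + τ • d ∈ s := by
  obtain ⟨y, hy, rfl⟩ := mem_intrinsicInterior.1 hx
  have hdir : ∀ τ : ℝ, (y : X) + τ • d ∈ affineSpan ℝ s := fun τ => by
    rw [add_comm]
    refine AffineSubspace.vadd_mem_of_mem_direction (v := τ • d) ?_ y.2
    rw [direction_affineSpan]
    exact Submodule.smul_mem _ _ hd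
  have hcont : Continuous fun τ : ℝ => (⟨(y : X) + τ • d, hdir τ⟩ : affineSpan ℝ s) := by
    fun_prop
  have h0 : (⟨(y : X) + (0 : ℝ) • d, hdir 0⟩ : affineSpan ℝ s) = y := by
    ext; simp
  have := hcont.tendsto 0
  rw [h0] at this
  exact (this.eventually (mem_interior_iff_mem_nhds.1 hy)).mono fun τ h => h

/-- A functional vanishing where `A` takes values in the lineality space of `K` is a pullback of an
element of the span of the polar cone. -/
theorem exists_span_polarCone_comp_eq [FiniteDimensional ℝ X] (A : X →L[ℝ] E)
    {s : StrongDual ℝ X} (hs : ∀ u, A u ∈ linealitySpace (K : Set E) → s u = 0) :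
    ∃ σ ∈ Submodule.span ℝ (polarCone K), σ.comp A = s := by
  let T : StrongDual ℝ E →ₗ[ℝ] Module.Dual ℝ X :=
    { toFun := fun σ => (σ.comp A).toLinearMap
      map_add' := fun _ _ => rfl
      map_smul' := fun _ _ => rfl }
  have : FiniteDimensional ℝ ((Submodule.span ℝ (polarCone K)).map T) :=
    FiniteDimensional.finiteDimensional_submodule _
  have hmem : s.toLinearMap ∈ (Submodule.span ℝ (polarCone K)).map T := by
    -- A finite-dimensional space of functionals is the annihilator of its common kernel. Here that
    -- kernel consists of the `u` with `A u` killed by all polar functionals, which by the bipolar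
    -- theorem means ±`A u` ∈ `K`.
    rw [← Subspace.dualCoannihilator_dualAnnihilator_eq
      (W := (Submodule.span ℝ (polarCone K)).map T), Submodule.mem_dualAnnihilator]
    intro u hu
    rw [Submodule.mem_dualCoannihilator] at hu
    have hz : ∀ η ∈ polarCone K, η (A u) = 0 := fun η hη =>
      hu _ (Submodule.mem_map_of_mem (f := T) (Submodule.subset_span hη))
    refine hs u (mem_linealitySpace.2 ⟨mem_of_forall_polarCone fun η hη => (hz η hη).le,
      mem_of_forall_polarCone fun η hη => ?_⟩)
    rw [map_neg, hz η hη, neg_zero]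
  obtain ⟨σ, hσ, h⟩ := hmem
  refine ⟨σ, hσ, ?_⟩
  ext u
  exact LinearMap.congr_fun h u

theorem apply_eq_zero_of_mem_span_polarCone {σ : StrongDual ℝ E}
    (hσ : σ ∈ Submodule.span ℝ (polarCone K)) {e : E}
    (he : e ∈ linealitySpace (K : Set E)) : σ e = 0 := by
  induction hσ using Submodule.span_induction with
  | mem η hη => exact apply_eq_zero_of_mem_linealitySpace hη he
  | zero => rfl
  | add _ _ _ _ h₁ h₂ => rw [_root_.add_apply, h₁, h₂, add_zero]
  | smul a _ _ h => rw [_root_.smul_apply, h, smul_zero]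

/-- `η` is a relative interior point of the polar cone of `K`: small shifts of `η` along its linear
span stay in it. -/
def IsRelInteriorPolar (K : ProperCone ℝ E) (η : StrongDual ℝ E) : Prop :=
  ∀ σ ∈ Submodule.span ℝ (polarCone K), ∀ᶠ τ : ℝ in 𝓝 0, η + τ • σ ∈ polarCone K

theorem IsRelInteriorPolar.mem {η : StrongDual ℝ E} (h : IsRelInteriorPolar K η) :
    η ∈ polarCone K := by
  have := (h 0 (Submodule.zero_mem _)).self_of_nhds
  simpa using this

/-- The face of `K` exposed by a relative interior point of the polar cone is the lineality
space. -/
theorem IsRelInteriorPolar.mem_linealitySpace {η : StrongDual ℝ E} (h : IsRelInteriorPolar K η)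
    {e : E} (he : e ∈ K) (hηe : η e = 0) : e ∈ linealitySpace (K : Set E) := by
  refine _root_.mem_linealitySpace.2 ⟨he, mem_of_forall_polarCone fun ν hν => ?_⟩
  obtain ⟨ε, hε, hball⟩ := Metric.eventually_nhds_iff.1 (h ν (Submodule.subset_span hν))
  -- Since η - (ε/2)ν is still polar and `η e = 0`, evaluation at `e` gives ν e ≥ 0.
  have h1 := hball (y := -(ε / 2)) (by
    rw [dist_zero_right, norm_neg, Real.norm_of_nonneg (half_pos hε).le]; linarith) e he
  rw [_root_.add_apply, _root_.smul_apply, hηe, zero_add, smul_eq_mul]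
    at h1
  rw [map_neg]
  nlinarith

end Cones

/-! ### Inverse images of cones -/

section InverseImages

variable {Y E : Type*} [NormedAddCommGroup Y] [NormedSpace ℝ Y]
  [NormedAddCommGroup E] [NormedSpace ℝ E] {K : ProperCone ℝ E}

theorem tendsto_inv_smul_sub {F : Y → E} {A : Y →L[ℝ] E} {z : Y}
    (hF : HasFDerivAt F A z) {t : ℕ → ℝ} {w : ℕ → Y} {w₀ : Y} (ht : ∀ n, 0 < t n)
    (htl : Tendsto t atTop (𝓝 0)) (hw : Tendsto w atTop (𝓝 w₀)) :
    Tendsto (fun n => (t n)⁻¹ • (F (z + t n • w n) - F z)) atTop (𝓝 (A w₀)) := by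
  refine (hasFDerivWithinAt_univ.2 hF).lim (by simpa using htl.smul hw)
    (.of_forall fun _ => mem_univ _) (hw.congr fun n => ?_)
  rw [smul_smul, inv_mul_cancel₀ (ht n).ne', one_smul]

theorem tendsto_add_smul {z : Y} {t : ℕ → ℝ} {w : ℕ → Y} {w₀ : Y}
    (htl : Tendsto t atTop (𝓝 0)) (hw : Tendsto w atTop (𝓝 w₀)) :
    Tendsto (fun n => z + t n • w n) atTop (𝓝 z) := by
  simpa using tendsto_const_nhds.add (htl.smul hw)

theorem map_mem_of_mem_contingentCone {F : Y → E} {A : Y →L[ℝ] E} {z : Y} {Ω : Set Y}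
    (hF : HasFDerivAt F A z) (hFz : F z = 0) (hΩ : ∀ᶠ z' in 𝓝 z, z' ∈ Ω → F z' ∈ K) {w : Y}
    (hw : w ∈ contingentCone Ω z) : A w ∈ K := by
  obtain ⟨t, w', ht, htl, hwl, hmem⟩ := hw
  refine K.isClosed.mem_of_tendsto (tendsto_inv_smul_sub hF ht htl hwl) ?_
  filter_upwards [(tendsto_add_smul htl hwl).eventually hΩ] with n hn
  rw [hFz, sub_zero]
  exact K.smul_mem (hn (hmem n)) (inv_nonneg.2 (ht n).le)

theorem mem_contingentCone_of_eventually {Ω : Set Y} {z w : Y} {t : ℕ → ℝ} {w' : ℕ → Y}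
    (ht : ∀ n, 0 < t n) (htl : Tendsto t atTop (𝓝 0)) (hw : Tendsto w' atTop (𝓝 w))
    (h : ∀ᶠ n in atTop, z + t n • w' n ∈ Ω) : w ∈ contingentCone Ω z := by
  obtain ⟨N, hN⟩ := eventually_atTop.1 h
  have hs : Tendsto (fun n : ℕ => n + N) atTop atTop := tendsto_add_atTop_nat N
  exact ⟨fun n => t (n + N), fun n => w' (n + N), fun n => ht _, htl.comp hs, hw.comp hs,
    fun n => hN _ (Nat.le_add_left N n)⟩

/-- As `F (z + t w)` differs from `t A w ∈ K` by o(t), the error bound moves `z + t w` into `Ω` by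
only o(t), which does not change the limit direction. -/
theorem mem_contingentCone_of_map_mem {F : Y → E} {A : Y →L[ℝ] E} {z : Y} {Ω : Set Y} {κ : ℝ}
    (hF : HasFDerivAt F A z) (hFz : F z = 0)
    (hR : ∀ᶠ z' in 𝓝 z, ∀ k ∈ K, ∃ z'' ∈ Ω, ‖z'' - z'‖ ≤ κ * ‖F z' - k‖) {w : Y}
    (hw : A w ∈ K) : w ∈ contingentCone Ω z := by
  set t : ℕ → ℝ := fun n => 1 / ((n : ℝ) + 1)
  have ht : ∀ n, 0 < t n := fun n => Nat.one_div_pos_of_nat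
  have htl : Tendsto t atTop (𝓝 0) := tendsto_one_div_add_atTop_nhds_zero_nat
  have hlim := tendsto_inv_smul_sub hF ht htl (tendsto_const_nhds (x := w))
  -- The error bound holds only for large n; elsewhere the point chosen is the irrelevant default 0.
  have hev : ∀ n, ∃ z'' : Y, (∀ k ∈ K, ∃ z'' ∈ Ω, ‖z'' - (z + t n • w)‖ ≤
      κ * ‖F (z + t n • w) - k‖) → z'' ∈ Ω ∧ ‖z'' - (z + t n • w)‖ ≤
      κ * ‖F (z + t n • w) - t n • A w‖ := fun n => by
    by_cases h : ∀ k ∈ K, ∃ z'' ∈ Ω, ‖z'' - (z + t n • w)‖ ≤ κ * ‖F (z + t n • w) - k‖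
    · obtain ⟨z'', h1, h2⟩ := h _ (K.smul_mem hw (ht n).le)
      exact ⟨z'', fun _ => ⟨h1, h2⟩⟩
    · exact ⟨0, fun h' => absurd h' h⟩
  choose y hy using hev
  have hgood := (tendsto_add_smul htl (tendsto_const_nhds (x := w))).eventually hR
  have hyt : ∀ n, z + t n • ((t n)⁻¹ • (y n - z)) = y n := fun n => by
    rw [smul_smul, mul_inv_cancel₀ (ht n).ne', one_smul, add_sub_cancel]
  refine mem_contingentCone_of_eventually (w' := fun n => (t n)⁻¹ • (y n - z)) ht htl ?_ ?_
  · rw [tendsto_iff_norm_sub_tendsto_zero]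
    have h0 : Tendsto (fun n => κ * ‖(t n)⁻¹ • (F (z + t n • w) - F z) - A w‖) atTop (𝓝 0) := by
      simpa using ((hlim.sub_const (A w)).norm.const_mul κ)
    refine squeeze_zero' (.of_forall fun _ => norm_nonneg _) ?_ h0
    filter_upwards [hgood] with n hn
    have h1 : (t n)⁻¹ • (y n - z) - w = (t n)⁻¹ • (y n - (z + t n • w)) := by
      rw [← sub_sub, smul_sub _ (y n - z), smul_smul, inv_mul_cancel₀ (ht n).ne', one_smul]
    have h2 : (t n)⁻¹ • (F (z + t n • w) - F z) - A w =
        (t n)⁻¹ • (F (z + t n • w) - t n • A w) := by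
      rw [hFz, sub_zero, smul_sub, smul_smul, inv_mul_cancel₀ (ht n).ne', one_smul]
    rw [h1, h2, norm_smul, norm_smul, mul_left_comm]
    exact mul_le_mul_of_nonneg_left (hy n hn).2 (norm_nonneg _)
  · filter_upwards [hgood] with n hn
    rw [hyt]
    exact (hy n hn).1

/-- Polar functionals pulled back by the derivative are regular normals to an inverse image. -/
theorem comp_mem_regularNormalCone {F : Y → E} {A : Y →L[ℝ] E} {z : Y} {Ω : Set Y}
    (hz : z ∈ Ω) (hF : HasFDerivAt F A z) (hFz : F z = 0)
    (hΩ : ∀ᶠ z' in 𝓝 z, z' ∈ Ω → F z' ∈ K)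
    {η : StrongDual ℝ E} (hη : η ∈ polarCone K) : η.comp A ∈ regularNormalCone Ω z := by
  refine ⟨hz, fun ε hε => ?_⟩
  have hd : HasFDerivAt (fun z' => η (F z')) (η.comp A) z := η.hasFDerivAt.comp z hF
  filter_upwards [nhdsWithin_le_nhds (hd.isLittleO.def hε), nhdsWithin_le_nhds hΩ,
    self_mem_nhdsWithin] with z' h1 h2 h3
  have h4 := hη _ (h2 h3)
  rw [hFz, map_zero, sub_zero, Real.norm_eq_abs] at h1
  have := (abs_le.1 h1).1
  linarith

theorem regularNormalCone_subset_limitingNormalCone (Ω : Set Y) (z : Y) :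
    regularNormalCone Ω z ⊆ limitingNormalCone Ω z := fun zs h =>
  ⟨h.1, fun _ => z, fun _ => zs, fun _ => h.1, tendsto_const_nhds, fun _ => h, tendsto_const_nhds⟩

/-- Inverse images under submersions are metrically regular. -/
theorem IsC2Reduction.exists_dist_le [FiniteDimensional ℝ Y] [FiniteDimensional ℝ E]
    {C : Set Y} {y : Y} {V : Set Y} {h : Y → E} (hred : IsC2Reduction C y K V h) :
    ∃ c : ℝ, 0 ≤ c ∧ ∀ᶠ y' in 𝓝 y, ∀ k ∈ K, ∃ y'' ∈ C, ‖y'' - y'‖ ≤ c * ‖h y' - k‖ := by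
  have hVn : V ∈ 𝓝 y := hred.isOpen.mem_nhds hred.mem
  have hcd : ContDiffAt ℝ 2 h y := hred.contDiffOn.contDiffAt hVn
  have hst : HasStrictFDerivAt h (fderiv ℝ h y) y := hcd.hasStrictFDerivAt (by simp)
  obtain ⟨S, hS⟩ := (fderiv ℝ h y).exists_nonlinearRightInverse_of_surjective
    (LinearMap.range_eq_top.2 hred.surjective)
  -- Half of the openness rate of the derivative is spent on the nonlinear error; the remainder `a`
  -- is the openness rate of `h`.
  obtain ⟨s, hs, happ⟩ := hst.approximates_deriv_on_nhds (c := S.nnnorm⁻¹ / 2)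
    (Or.inr (half_pos (inv_pos.2 hS)))
  set a : ℝ := (S.nnnorm : ℝ)⁻¹ - ((S.nnnorm⁻¹ / 2 : ℝ≥0) : ℝ) with ha
  have ha0 : 0 < a := by
    have : (0 : ℝ) < (S.nnnorm : ℝ)⁻¹ := inv_pos.2 hS
    rw [ha]; push_cast; linarith
  obtain ⟨r, hr, hball⟩ := Metric.mem_nhds_iff.1 (inter_mem hs hVn)
  refine ⟨a⁻¹, (inv_pos.2 ha0).le, ?_⟩
  have hsmall : ∀ᶠ y' in 𝓝 y, ‖h y'‖ < a * (r / 2) := by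
    have : Tendsto (fun y' => ‖h y'‖) (𝓝 y) (𝓝 0) := by
      have := hcd.continuousAt.norm.tendsto
      rwa [hred.map_eq_zero, norm_zero] at this
    exact this.eventually_lt_const (by positivity)
  filter_upwards [Metric.ball_mem_nhds y (half_pos hr), hsmall] with y' hy' hy'2
  have hsub : ∀ ε ≤ r / 2, Metric.closedBall y' ε ⊆ s ∩ V := fun ε hε => by
    refine Subset.trans (fun w hw => ?_) hball
    rw [Metric.mem_ball] at *
    have := dist_triangle w y' y
    have hw' := Metric.mem_closedBall.1 hw
    linarith
  have main : ∀ k ∈ K, a⁻¹ * ‖h y' - k‖ ≤ r / 2 →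
      ∃ y'' ∈ C, ‖y'' - y'‖ ≤ a⁻¹ * ‖h y' - k‖ := by
    intro k hk hle
    have hk' : k ∈ Metric.closedBall (h y') (a * (a⁻¹ * ‖h y' - k‖)) := by
      rw [mul_inv_cancel_left₀ ha0.ne', Metric.mem_closedBall, dist_eq_norm, norm_sub_rev]
    obtain ⟨y'', h1, h2⟩ := happ.surjOn_closedBall_of_nonlinearRightInverse S
      (mul_nonneg (inv_pos.2 ha0).le (norm_nonneg _))
      ((hsub _ hle).trans inter_subset_left) hk'
    refine ⟨y'', ?_, by rwa [Metric.mem_closedBall, dist_eq_norm] at h1⟩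
    have : y'' ∈ C ∩ V := by
      rw [hred.inter_eq]
      exact ⟨(hsub _ hle h1).2, by rw [h2]; exact hk⟩
    exact this.1
  intro k hk
  -- For `k` beyond the reach of local solvability, the target `0 ∈ K` is used instead: it is
  -- reachable, and closer than the bound demanded for `k`.
  rcases le_or_gt (a⁻¹ * ‖h y' - k‖) (r / 2) with hle | hlt
  · exact main k hk hle
  · have h0 : a⁻¹ * ‖h y' - 0‖ ≤ r / 2 := by
      rw [sub_zero, inv_mul_le_iff₀ ha0]; exact hy'2.le
    obtain ⟨y'', h1, h2⟩ := main 0 K.zero_mem h0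
    exact ⟨y'', h1, h2.trans (h0.trans hlt.le)⟩

theorem IsC2Reduction.contDiffAt {C : Set Y} {y : Y} {V : Set Y} {h : Y → E}
    (hred : IsC2Reduction C y K V h) : ContDiffAt ℝ 2 h y :=
  hred.contDiffOn.contDiffAt (hred.isOpen.mem_nhds hred.mem)

theorem IsC2Reduction.hasFDerivAt {C : Set Y} {y : Y} {V : Set Y} {h : Y → E}
    (hred : IsC2Reduction C y K V h) : HasFDerivAt h (fderiv ℝ h y) y :=
  (hred.contDiffAt.differentiableAt (by simp)).hasFDerivAt

theorem IsC2Reduction.eventually_mem_iff {C : Set Y} {y : Y} {V : Set Y} {h : Y → E}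
    (hred : IsC2Reduction C y K V h) : ∀ᶠ y' in 𝓝 y, y' ∈ C ↔ h y' ∈ K := by
  filter_upwards [hred.isOpen.mem_nhds hred.mem] with y' hy'
  have := Set.ext_iff.1 hred.inter_eq y'
  simpa [hy'] using this

/-- Since `h y = 0`, complementarity at `y` is automatic and pullbacks of polar functionals are
already regular normals. The converse is the multiplier rule, available through `exists_dist_le`. -/
theorem IsC2Reduction.limitingNormalCone_eq [FiniteDimensional ℝ Y] [FiniteDimensional ℝ E]
    {C : Set Y} {y : Y} {V : Set Y} {h : Y → E} (hred : IsC2Reduction C y K V h) :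
    limitingNormalCone C y = (fun η => η.comp (fderiv ℝ h y)) '' polarCone K := by
  have hmem : ∀ᶠ y' in 𝓝 y, y' ∈ C → h y' ∈ K := hred.eventually_mem_iff.mono fun _ h => h.1
  ext ys
  constructor
  · intro hys
    obtain ⟨c, hc, hR⟩ := hred.exists_dist_le
    obtain ⟨η, hη, -, h2, -⟩ := exists_multiplier_of_mem_limitingNormalCone hc
      (hred.contDiffAt.of_le (by norm_num)) hmem hR hys
    exact ⟨η, hη, h2⟩
  · rintro ⟨η, hη, rfl⟩
    refine regularNormalCone_subset_limitingNormalCone _ _ (comp_mem_regularNormalCone ?_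
      hred.hasFDerivAt hred.map_eq_zero hmem hη)
    refine hred.eventually_mem_iff.self_of_nhds.2 ?_
    rw [hred.map_eq_zero]
    exact K.zero_mem

theorem comp_injective_of_surjective {A : Y →L[ℝ] E} (hA : Function.Surjective A) :
    Function.Injective (fun μ : StrongDual ℝ E => μ.comp A) :=
  Function.LeftInverse.injective (adjointInv_comp A hA)

/-- Pullbacks of the span of the polar cone are directions of the affine hull of the normal cone
because 0 is a normal; injectivity of the adjoint brings shifted normals back to polar functionals.
-/
theorem IsC2Reduction.isRelInteriorPolar [FiniteDimensional ℝ Y] [FiniteDimensional ℝ E]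
    {C : Set Y} {y : Y} {V : Set Y} {h : Y → E} (hred : IsC2Reduction C y K V h)
    {μ : StrongDual ℝ Y} (hμ : μ ∈ intrinsicInterior ℝ (limitingNormalCone C y)) :
    ∃ η, IsRelInteriorPolar K η ∧ η.comp (fderiv ℝ h y) = μ := by
  rw [hred.limitingNormalCone_eq] at hμ
  obtain ⟨η, hη, rfl⟩ := intrinsicInterior_subset hμ
  refine ⟨η, fun σ hσ => ?_, rfl⟩
  set N := (fun η : StrongDual ℝ E => η.comp (fderiv ℝ h y)) '' polarCone K with hN
  have hspan : σ.comp (fderiv ℝ h y) ∈ vectorSpan ℝ N := by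
    induction hσ using Submodule.span_induction with
    | mem ν hν =>
      have h0 : (0 : StrongDual ℝ Y) ∈ N := ⟨0, fun _ _ => le_rfl, ContinuousLinearMap.zero_comp _⟩
      have h1 : ν.comp (fderiv ℝ h y) ∈ N := ⟨ν, hν, rfl⟩
      simpa using vsub_mem_vectorSpan ℝ h1 h0
    | zero => rw [ContinuousLinearMap.zero_comp]; exact Submodule.zero_mem _
    | add _ _ _ _ h₁ h₂ => rw [ContinuousLinearMap.add_comp]; exact Submodule.add_mem _ h₁ h₂
    | smul a _ _ h => rw [ContinuousLinearMap.smul_comp]; exact Submodule.smul_mem _ _ h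
  filter_upwards [eventually_add_smul_mem_of_mem_intrinsicInterior hμ hspan] with τ hτ
  obtain ⟨ν, hν, hντ⟩ := hτ
  have : ν = η + τ • σ := by
    refine comp_injective_of_surjective hred.surjective ?_
    simpa [ContinuousLinearMap.add_comp, ContinuousLinearMap.smul_comp] using hντ
  rwa [← this]

end InverseImages

/-! ### Parametric systems constrained by a cone -/

section ConeSystems

variable {P X E : Type*} [NormedAddCommGroup P] [NormedSpace ℝ P]
  [NormedAddCommGroup X] [NormedSpace ℝ X] [NormedAddCommGroup E] [NormedSpace ℝ E]

/-- Near `z`, where `F` is `C²` and vanishes, the graph of `Γ` is described by the Robinson stable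
(with constant `κ`) system `F(z) ∈ K`. -/
structure IsConeSystem (F : P × X → E) (Γ : P → Set X) (K : ProperCone ℝ E) (κ : ℝ)
    (z : P × X) : Prop where
  contDiffAt : ContDiffAt ℝ 2 F z
  map_eq_zero : F z = 0
  nonneg : 0 ≤ κ
  eventually_mem_iff : ∀ᶠ z' in 𝓝 z, z'.2 ∈ Γ z'.1 ↔ F z' ∈ K
  eventually_exists : ∀ᶠ z' in 𝓝 z, ∀ k ∈ K, ∃ x ∈ Γ z'.1, ‖x - z'.2‖ ≤ κ * ‖F z' - k‖

theorem HasFDerivAt.comp_prodMk_right {F : P × X → E} {A : P × X →L[ℝ] E} {z : P × X}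
    (h : HasFDerivAt F A z) :
    HasFDerivAt (fun x => F (z.1, x)) (A.comp (ContinuousLinearMap.inr ℝ P X)) z.2 :=
  HasFDerivAt.comp z.2 (g := F) (by exact h) (hasFDerivAt_prodMk_right z.1 z.2)

/-- Lets the multiplier rule be applied at each nearby frozen parameter, with the same constant. -/
theorem eventually_eventually_prodMk {P X : Type*} [TopologicalSpace P] [TopologicalSpace X]
    {z : P × X} {Q : P × X → Prop} (h : ∀ᶠ z' in 𝓝 z, Q z') :
    ∀ᶠ z' in 𝓝 z, ∀ᶠ x in 𝓝 z'.2, Q (z'.1, x) := by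
  filter_upwards [h.eventually_nhds] with z' hz'
  have hc : Tendsto (fun x => (z'.1, x)) (𝓝 z'.2) (𝓝 z') :=
    (Continuous.prodMk_right z'.1).tendsto z'.2
  exact hc.eventually hz'

namespace IsConeSystem

variable {F : P × X → E} {Γ : P → Set X} {K : ProperCone ℝ E} {κ : ℝ} {z : P × X}

theorem hasFDerivAt (hS : IsConeSystem F Γ K κ z) : HasFDerivAt F (fderiv ℝ F z) z :=
  (hS.contDiffAt.differentiableAt (by simp)).hasFDerivAt

theorem eventually_hasFDerivAt (hS : IsConeSystem F Γ K κ z) :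
    ∀ᶠ z' in 𝓝 z, HasFDerivAt F (fderiv ℝ F z') z' :=
  (hS.contDiffAt.eventually (by simp)).mono fun _ h =>
    (h.differentiableAt (by simp)).hasFDerivAt

theorem hasFDerivAt_fderiv (hS : IsConeSystem F Γ K κ z) :
    HasFDerivAt (fderiv ℝ F) (fderiv ℝ (fderiv ℝ F) z) z :=
  ((hS.contDiffAt.fderiv_right (m := 1) (by norm_num)).differentiableAt (by simp)).hasFDerivAt

/-- Robinson stability corrects only the X-component; a displacement with zero P-part has the norm
of that component, so the same estimate serves for the graph. -/
theorem mem_contingentCone_iff (hS : IsConeSystem F Γ K κ z) {w : P × X} :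
    w ∈ contingentCone (graphOf Γ) z ↔ fderiv ℝ F z w ∈ K := by
  refine ⟨map_mem_of_mem_contingentCone hS.hasFDerivAt hS.map_eq_zero
    (hS.eventually_mem_iff.mono fun _ h => h.1),
    mem_contingentCone_of_map_mem (κ := κ) hS.hasFDerivAt hS.map_eq_zero ?_⟩
  filter_upwards [hS.eventually_exists] with z' hz' k hk
  obtain ⟨x, hx, hle⟩ := hz' k hk
  refine ⟨(z'.1, x), hx, ?_⟩
  rwa [Prod.norm_def, Prod.fst_sub, Prod.snd_sub, sub_self, norm_zero,
    max_eq_right (norm_nonneg _)]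

/-- The multiplier rule, uniformly around the reference point. -/
theorem eventually_exists_multiplier [FiniteDimensional ℝ E] (hS : IsConeSystem F Γ K κ z) :
    ∀ᶠ z' in 𝓝 z, ∀ xs ∈ limitingNormalCone (Γ z'.1) z'.2, ∃ η ∈ polarCone K, η (F z') = 0 ∧
      η.comp ((fderiv ℝ F z').comp (ContinuousLinearMap.inr ℝ P X)) = xs ∧
        ‖η‖ ≤ κ * ‖xs‖ := by
  filter_upwards [hS.contDiffAt.eventually (by simp), hS.eventually_hasFDerivAt,
    eventually_eventually_prodMk hS.eventually_mem_iff,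
    eventually_eventually_prodMk hS.eventually_exists] with z' h1 h2 h3 h4 xs hxs
  have hc : ContDiffAt ℝ 1 (fun x => F (z'.1, x)) z'.2 :=
    ContDiffAt.comp z'.2 (g := F) (by exact h1.of_le (by norm_num))
      (contDiffAt_const.prodMk contDiffAt_id)
  have := exists_multiplier_of_mem_limitingNormalCone (K := K) hS.nonneg hc
    (h3.mono fun _ h => h.1) h4 hxs
  rwa [h2.comp_prodMk_right.fderiv] at this

/-- The graphical derivative of the normal cone mapping: multipliers and the first-order part. -/
theorem exists_multiplier_of_mem_graphicalDerivative [FiniteDimensional ℝ E]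
    (hS : IsConeSystem F Γ K κ z) {xs : StrongDual ℝ X} {v : P × X} {us : StrongDual ℝ X}
    (hus : us ∈ graphicalDerivative (fun z' => limitingNormalCone (Γ z'.1) z'.2) z xs v) :
    fderiv ℝ F z v ∈ K ∧ ∃ η ∈ polarCone K, η (fderiv ℝ F z v) = 0 ∧
      η.comp ((fderiv ℝ F z).comp (ContinuousLinearMap.inr ℝ P X)) = xs ∧
      ∀ u : X, fderiv ℝ F z (0, u) ∈ linealitySpace (K : Set E) →
        (us - η.comp ((fderiv ℝ (fderiv ℝ F) z v).comp (ContinuousLinearMap.inr ℝ P X))) u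
          = 0 := by
  obtain ⟨t, w, ht, htl, hwl, hmem⟩ := hus
  have hvl : Tendsto (fun n => (w n).1) atTop (𝓝 v) := (continuous_fst.tendsto _).comp hwl
  have hul : Tendsto (fun n => (w n).2) atTop (𝓝 us) := (continuous_snd.tendsto _).comp hwl
  set zn : ℕ → P × X := fun n => z + t n • (w n).1 with hzn
  have hzl : Tendsto zn atTop (𝓝 z) := tendsto_add_smul htl hvl
  have hmem' : ∀ n, xs + t n • (w n).2 ∈ limitingNormalCone (Γ (zn n).1) (zn n).2 := hmem
  have hxl : Tendsto (fun n => xs + t n • (w n).2) atTop (𝓝 xs) := tendsto_add_smul htl hul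
  obtain ⟨N, hN⟩ := eventually_atTop.1
    ((hzl.eventually hS.eventually_exists_multiplier).and (hzl.eventually hS.eventually_mem_iff))
  choose η hηK hη0 hηA hηn using fun n => (hN (n + N) (Nat.le_add_left N n)).1 _ (hmem' (n + N))
  have hshift : Tendsto (fun n : ℕ => n + N) atTop atTop := tendsto_add_atTop_nat N
  obtain ⟨M, hM⟩ := (hxl.comp hshift).norm.bddAbove_range
  have hbdd : ∀ n, η n ∈ Metric.closedBall (0 : StrongDual ℝ E) (κ * M) := fun n => by
    rw [mem_closedBall_zero_iff]
    exact (hηn n).trans (mul_le_mul_of_nonneg_left (hM ⟨n, rfl⟩) hS.nonneg)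
  obtain ⟨η₀, -, φ, hφ, hlim⟩ := tendsto_subseq_of_bounded Metric.isBounded_closedBall hbdd
  have hθ : Tendsto (fun n => φ n + N) atTop atTop := hshift.comp hφ.tendsto_atTop
  have hηlim : Tendsto (fun n => η (φ n)) atTop (𝓝 η₀) := hlim
  have hη₀ : η₀ ∈ polarCone K := fun k hk =>
    le_of_tendsto' (tendsto_clm_apply hηlim tendsto_const_nhds) fun n => hηK _ k hk
  have hFd : Tendsto (fun n => (t (φ n + N))⁻¹ • (F (zn (φ n + N)) - F z)) atTop
      (𝓝 (fderiv ℝ F z v)) :=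
    tendsto_inv_smul_sub (w := fun n => (w (φ n + N)).1) hS.hasFDerivAt (fun n => ht _)
      (htl.comp hθ) (hvl.comp hθ)
  have hFdd : Tendsto (fun n => (t (φ n + N))⁻¹ • (fderiv ℝ F (zn (φ n + N)) - fderiv ℝ F z))
      atTop (𝓝 (fderiv ℝ (fderiv ℝ F) z v)) :=
    tendsto_inv_smul_sub (w := fun n => (w (φ n + N)).1) hS.hasFDerivAt_fderiv (fun n => ht _)
      (htl.comp hθ) (hvl.comp hθ)
  have hfd : Tendsto (fun n => fderiv ℝ F (zn (φ n + N))) atTop (𝓝 (fderiv ℝ F z)) :=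
    hS.hasFDerivAt_fderiv.continuousAt.tendsto.comp (hzl.comp hθ)
  have hη₀A : η₀.comp ((fderiv ℝ F z).comp (ContinuousLinearMap.inr ℝ P X)) = xs := by
    refine tendsto_nhds_unique (tendsto_clm_comp hηlim
      (tendsto_clm_comp hfd tendsto_const_nhds)) ?_
    exact (hxl.comp hθ).congr fun n => (hηA _).symm
  refine ⟨?_, η₀, hη₀, ?_, hη₀A, fun u hu => ?_⟩
  · refine K.isClosed.mem_of_tendsto hFd (.of_forall fun n => ?_)
    rw [hS.map_eq_zero, sub_zero]
    exact K.smul_mem ((hN (φ n + N) (Nat.le_add_left _ _)).2.1 (hmem' _).1)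
      (inv_nonneg.2 (ht _).le)
  · refine tendsto_nhds_unique (tendsto_clm_apply hηlim hFd) ?_
    refine tendsto_const_nhds.congr fun n => ?_
    rw [hS.map_eq_zero, sub_zero, map_smul, hη0, smul_zero]
  · have h1 : Tendsto (fun n => (w (φ n + N)).2 u) atTop (𝓝 (us u)) :=
      tendsto_clm_apply (hul.comp hθ) tendsto_const_nhds
    have h2 : Tendsto (fun n => η (φ n)
        (((t (φ n + N))⁻¹ • (fderiv ℝ F (zn (φ n + N)) - fderiv ℝ F z)) (0, u))) atTop
        (𝓝 (η₀ (fderiv ℝ (fderiv ℝ F) z v (0, u)))) :=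
      tendsto_clm_apply hηlim (tendsto_clm_apply hFdd tendsto_const_nhds)
    -- All multipliers kill `fderiv ℝ F z (0, u)`, so subtracting it is free and the multiplier
    -- equation divided by t becomes a difference quotient of the derivative.
    have h3 : us u = η₀ (fderiv ℝ (fderiv ℝ F) z v (0, u)) := by
      refine tendsto_nhds_unique h1 (h2.congr fun n => ?_)
      have h4 := DFunLike.congr_fun (hηA (φ n)) u
      have h5 : η (φ n) (fderiv ℝ F (zn (φ n + N)) (0, u)) =
          xs u + t (φ n + N) * (w (φ n + N)).2 u := h4
      have h6 : xs u = 0 := by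
        rw [← hη₀A]
        exact apply_eq_zero_of_mem_linealitySpace hη₀ hu
      rw [_root_.smul_apply, _root_.sub_apply, map_smul, map_sub,
        apply_eq_zero_of_mem_linealitySpace (hηK _) hu, sub_zero, h5, h6, zero_add, smul_eq_mul,
        inv_mul_cancel_left₀ (ht _).ne']
    show us u - η₀ (fderiv ℝ (fderiv ℝ F) z v (0, u)) = 0
    rw [h3, sub_self]

end IsConeSystem

/-- Critical directions with characteristic parameter are mapped into the lineality space. -/
theorem map_mem_linealitySpace_of_critical {K : ProperCone ℝ E} {A : P × X →L[ℝ] E}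
    {η₀ η : StrongDual ℝ E} (hη₀ : IsRelInteriorPolar K η₀) (hη : η ∈ polarCone K)
    (hA : η.comp (A.comp (ContinuousLinearMap.inr ℝ P X)) =
      η₀.comp (A.comp (ContinuousLinearMap.inr ℝ P X)))
    {v : P × X} {u₀ : X} (hu₀ : A (v.1, u₀) ∈ linealitySpace (K : Set E)) (hv : A v ∈ K)
    (hηv : η (A v) = 0) : A v ∈ linealitySpace (K : Set E) := by
  -- The first summand lies in the lineality space; on the second, `η` and `η₀` agree, so the face
  -- exposed by `η₀` decides.
  have hdecomp : A v = A (v.1, u₀) + A (0, v.2 - u₀) := by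
    rw [← map_add]; congr 1; ext <;> simp
  have h1 : A (0, v.2 - u₀) ∈ K := by
    have : A (0, v.2 - u₀) = A v + -A (v.1, u₀) := by rw [hdecomp]; abel
    rw [this]
    exact K.add_mem hv (mem_linealitySpace.1 hu₀).2
  have h2 : η₀ (A (0, v.2 - u₀)) = 0 := by
    have h3 : η (A (0, v.2 - u₀)) = η₀ (A (0, v.2 - u₀)) := DFunLike.congr_fun hA (v.2 - u₀)
    rw [← h3]
    rw [hdecomp, map_add, apply_eq_zero_of_mem_linealitySpace hη hu₀, zero_add] at hηv
    exact hηv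
  rw [hdecomp]
  exact linealitySpace_add hu₀ (hη₀.mem_linealitySpace h1 h2)

/-- A functional vanishing on the critical directions of the fixed-parameter system extends to a
normal to the critical cone of the whole system. -/
theorem exists_polar_extension [FiniteDimensional ℝ X] {K : ProperCone ℝ E} {A : P × X →L[ℝ] E}
    {η₀ η : StrongDual ℝ E} (hη₀ : IsRelInteriorPolar K η₀) (hη : η ∈ polarCone K)
    (hA : η.comp (A.comp (ContinuousLinearMap.inr ℝ P X)) =
      η₀.comp (A.comp (ContinuousLinearMap.inr ℝ P X)))
    {s : StrongDual ℝ X} (hs : ∀ u, A (0, u) ∈ linealitySpace (K : Set E) → s u = 0) :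
    ∃ ζ : StrongDual ℝ E, ζ.comp (A.comp (ContinuousLinearMap.inr ℝ P X)) = s ∧
      (∀ e ∈ K, η e = 0 → ζ e ≤ 0) ∧ ∀ e ∈ linealitySpace (K : Set E), ζ e = 0 := by
  obtain ⟨σ, hσ, hσA⟩ := exists_span_polarCone_comp_eq
    (A.comp (ContinuousLinearMap.inr ℝ P X)) hs
  obtain ⟨ε, hε, hball⟩ := Metric.eventually_nhds_iff.1 (hη₀ σ hσ)
  have hmem := hball (y := ε / 2) (by
    rw [dist_zero_right, Real.norm_of_nonneg (half_pos hε).le]; linarith)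
  have hε2 := half_pos hε
  -- The added term has zero pullback to X. Where `η e = 0`, the sum equals (2/ε)(η₀ + (ε/2)σ), a
  -- multiple of a polar functional.
  refine ⟨σ + (ε / 2)⁻¹ • (η₀ - η), ?_, fun e he hηe => ?_, fun e he => ?_⟩
  · rw [ContinuousLinearMap.add_comp, ContinuousLinearMap.smul_comp, ContinuousLinearMap.sub_comp,
      hA, sub_self, smul_zero, add_zero, hσA]
  · have h := hmem e he
    have : (σ + (ε / 2)⁻¹ • (η₀ - η)) e = (ε / 2)⁻¹ * (η₀ + (ε / 2) • σ) e := by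
      simp only [_root_.add_apply, _root_.smul_apply, _root_.sub_apply, hηe, smul_eq_mul]
      field_simp
      ring
    rw [this]
    exact mul_nonpos_of_nonneg_of_nonpos (inv_pos.2 hε2).le h
  · simp only [_root_.add_apply, _root_.smul_apply, _root_.sub_apply,
      apply_eq_zero_of_mem_span_polarCone hσ he, apply_eq_zero_of_mem_linealitySpace hη he,
      apply_eq_zero_of_mem_linealitySpace hη₀.mem he, sub_self, smul_zero, add_zero]

/-- A limiting normal vanishes along directions leaving the set invariant. -/
theorem apply_eq_zero_of_mem_limitingNormalCone {Z : Type*} [NormedAddCommGroup Z]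
    [NormedSpace ℝ Z] {Ω : Set Z} {v d : Z} (hd : ∀ w ∈ Ω, ∀ τ : ℝ, w + τ • d ∈ Ω)
    {ws : StrongDual ℝ Z} (hws : ws ∈ limitingNormalCone Ω v) : ws d = 0 := by
  obtain ⟨-, v', ws', hv', -, hreg, hlim⟩ := hws
  have key : ∀ n, ∀ d : Z, (∀ w ∈ Ω, ∀ τ : ℝ, w + τ • d ∈ Ω) → ws' n d ≤ 0 := by
    intro n d hd
    refine le_of_forall_pos_le_add fun δ hδ => ?_
    set ε : ℝ := δ / (‖d‖ + 1) with hε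
    have hε0 : 0 < ε := by positivity
    have htend : Tendsto (fun τ : ℝ => v' n + τ • d) (𝓝[>] 0) (𝓝[Ω] (v' n)) := by
      rw [tendsto_nhdsWithin_iff]
      refine ⟨?_, .of_forall fun τ => hd _ (hv' n) τ⟩
      have : Tendsto (fun τ : ℝ => v' n + τ • d) (𝓝 0) (𝓝 (v' n + (0 : ℝ) • d)) :=
        Continuous.tendsto (by fun_prop) 0
      rw [zero_smul, add_zero] at this
      exact this.mono_left nhdsWithin_le_nhds
    obtain ⟨τ, hτ, hτ0⟩ := ((htend.eventually ((hreg n).2 ε hε0)).and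
      eventually_mem_nhdsWithin).exists
    have hτ0' : (0 : ℝ) < τ := hτ0
    rw [add_sub_cancel_left, map_smul, norm_smul, Real.norm_of_nonneg hτ0'.le, smul_eq_mul,
      mul_left_comm] at hτ
    have h1 := le_of_mul_le_mul_left hτ hτ0'
    have h2 : ε * ‖d‖ ≤ δ := by
      rw [hε, div_mul_eq_mul_div, div_le_iff₀ (by positivity)]
      nlinarith [norm_nonneg d]
    linarith
  have hz : ∀ n, ws' n d = 0 := fun n => by
    refine le_antisymm (key n d hd) ?_
    have := key n (-d) fun w hw τ => by
      rw [smul_neg, ← neg_smul]; exact hd w hw (-τ)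
    rwa [map_neg, neg_nonpos] at this
  refine tendsto_nhds_unique (tendsto_clm_apply hlim tendsto_const_nhds) ?_
  exact tendsto_const_nhds.congr fun n => (hz n).symm

/-- A polar functional vanishing at a point of a set on which it is nonpositive is a normal. -/
theorem mem_limitingNormalCone_of_le {Z : Type*} [NormedAddCommGroup Z]
    [NormedSpace ℝ Z] {Ω : Set Z} {v : Z} (hv : v ∈ Ω) {ws : StrongDual ℝ Z}
    (hle : ∀ w ∈ Ω, ws w ≤ 0) (h0 : ws v = 0) : ws ∈ limitingNormalCone Ω v := by
  refine regularNormalCone_subset_limitingNormalCone _ _ ⟨hv, fun ε hε => ?_⟩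
  filter_upwards [self_mem_nhdsWithin] with w hw
  rw [map_sub, h0, sub_zero]
  exact (hle w hw).trans (mul_nonneg hε.le (norm_nonneg _))

end ConeSystems

/-! ### Penalization and second-order feasible arcs -/

section Penalization

variable {X E : Type*} [NormedAddCommGroup X] [NormedSpace ℝ X] [FiniteDimensional ℝ X]
  [NormedAddCommGroup E] [NormedSpace ℝ E]

/-- The gradient `u ↦ 2⟨u, ·⟩` of the squared Euclidean norm. -/
noncomputable def euclideanGradient (u : X) : StrongDual ℝ X :=
  (2 : ℝ) • (innerSL ℝ (toEuclidean u)).comp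
    (toEuclidean : X ≃L[ℝ] EuclideanSpace ℝ (Fin (Module.finrank ℝ X))).toContinuousLinearMap

theorem euclideanGradient_smul (a : ℝ) (u : X) :
    euclideanGradient (a • u) = a • euclideanGradient u := by
  ext x
  simp [euclideanGradient, mul_left_comm]

theorem tendsto_euclideanGradient {u : ℕ → X} (hu : Tendsto u atTop (𝓝 0)) :
    Tendsto (fun n => euclideanGradient (u n)) atTop (𝓝 0) := by
  have hc : Tendsto (fun n => innerSL ℝ (toEuclidean (u n))) atTop (𝓝 0) := by
    have : Tendsto (fun n => innerSL ℝ (toEuclidean (u n))) atTop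
        (𝓝 (innerSL ℝ (toEuclidean (0 : X)))) :=
      (((innerSL ℝ).continuous.comp toEuclidean.continuous).tendsto (0 : X)).comp hu
    rwa [map_zero, map_zero] at this
  have := (tendsto_clm_comp hc (tendsto_const_nhds (x :=
    (toEuclidean : X ≃L[ℝ] EuclideanSpace ℝ (Fin (Module.finrank ℝ X))).toContinuousLinearMap))
    ).const_smul (2 : ℝ)
  simpa [euclideanGradient] using this

theorem hasFDerivAt_norm_toEuclidean_sq (y x : X) :
    HasFDerivAt (fun x => ‖toEuclidean (x - y)‖ ^ 2) (euclideanGradient (x - y)) x := by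
  have h : HasFDerivAt (fun x : X => toEuclidean (x - y))
      (toEuclidean : X ≃L[ℝ] EuclideanSpace ℝ (Fin (Module.finrank ℝ X))).toContinuousLinearMap x :=
    (ContinuousLinearEquiv.hasFDerivAt _).comp x ((hasFDerivAt_id x).sub_const y)
  have h2 := h.norm_sq
  rwa [← Nat.cast_smul_eq_nsmul ℝ] at h2

/-- Negative gradients at local minimizers over a set are regular normals. -/
theorem neg_mem_regularNormalCone_of_isLocalMinOn {X : Type*} [NormedAddCommGroup X]
    [NormedSpace ℝ X] {Γ : Set X} {φ : X → ℝ} {φ' : StrongDual ℝ X} {x : X} (hx : x ∈ Γ)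
    (hmin : ∀ᶠ x' in 𝓝[Γ] x, φ x ≤ φ x') (hφ : HasFDerivAt φ φ' x) :
    -φ' ∈ regularNormalCone Γ x := by
  refine ⟨hx, fun ε hε => ?_⟩
  filter_upwards [nhdsWithin_le_nhds (hφ.isLittleO.def hε), hmin] with x' h1 h2
  rw [Real.norm_eq_abs] at h1
  have := (abs_le.1 h1).2
  rw [_root_.neg_apply]
  linarith

/-- Penalizing the distance to `y`, one finds near `y` a point of an inverse image at which a given
polar functional is almost a multiplier. -/
theorem exists_regularNormal_of_penalty {Γ : Set X} {G : X → E} {K : ProperCone ℝ E} {x₀ : X}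
    {r : ℝ} (hcont : ContinuousOn G (Metric.closedBall x₀ r))
    (hiff : ∀ x ∈ Metric.closedBall x₀ r, x ∈ Γ ↔ G x ∈ K)
    {η : StrongDual ℝ E} (hη : η ∈ polarCone K) (y : X) {x' : X}
    (hx' : x' ∈ Metric.closedBall x₀ r) (hx'Γ : x' ∈ Γ) :
    ∃ x ∈ Metric.closedBall x₀ r, x ∈ Γ ∧
      ‖toEuclidean (x - y)‖ ^ 2 ≤ ‖toEuclidean (x' - y)‖ ^ 2 - η (G x') ∧
      (x ∈ Metric.ball x₀ r → ∀ A : X →L[ℝ] E, HasFDerivAt G A x →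
        η.comp A - euclideanGradient (x - y) ∈ regularNormalCone Γ x) := by
  set S : Set X := Metric.closedBall x₀ r ∩ G ⁻¹' K with hS
  have hcomp : IsCompact S := by
    refine (isCompact_closedBall x₀ r).of_isClosed_subset ?_ inter_subset_left
    exact hcont.preimage_isClosed_of_isClosed Metric.isClosed_closedBall K.isClosed
  -- The Euclidean norm replaces that of X, which need not be differentiable.
  set φ : X → ℝ := fun x => ‖toEuclidean (x - y)‖ ^ 2 - η (G x) with hφ
  have hφc : ContinuousOn φ S := by
    refine ContinuousOn.sub ?_ (η.continuous.comp_continuousOn (hcont.mono inter_subset_left))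
    exact Continuous.continuousOn (((toEuclidean.continuous.comp
      (continuous_id.sub continuous_const)).norm).pow 2)
  have hx'S : x' ∈ S := ⟨hx', (hiff x' hx').1 hx'Γ⟩
  obtain ⟨x, hxS, hmin⟩ := hcomp.exists_isMinOn ⟨x', hx'S⟩ hφc
  have hxΓ : x ∈ Γ := (hiff x hxS.1).2 hxS.2
  refine ⟨x, hxS.1, hxΓ, ?_, fun hxb A hA => ?_⟩
  · have h1 : φ x ≤ φ x' := hmin hx'S
    -- The penalty `-η (G x)` is nonnegative at feasible points, so it can be dropped at the
    -- minimizer.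
    have h2 : η (G x) ≤ 0 := hη _ hxS.2
    simp only [hφ] at h1
    linarith
  · have hd : HasFDerivAt φ (euclideanGradient (x - y) - η.comp A) x :=
      (hasFDerivAt_norm_toEuclidean_sq y x).sub (η.hasFDerivAt.comp x hA)
    have := neg_mem_regularNormalCone_of_isLocalMinOn hxΓ ?_ hd
    · rwa [neg_sub] at this
    · filter_upwards [nhdsWithin_le_nhds (Metric.isOpen_ball.mem_nhds hxb), self_mem_nhdsWithin]
        with w hw hwΓ
      have hw' := Metric.ball_subset_closedBall hw
      exact hmin ⟨hw', (hiff w hw').1 hwΓ⟩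

/-- Second-order expansion along a parabolic arc. -/
theorem isLittleO_parabolic_arc {Z : Type*} [NormedAddCommGroup Z] [NormedSpace ℝ Z]
    {F : Z → E} {z : Z} (hF : ContDiffAt ℝ 2 F z) (v w : Z) :
    (fun τ : ℝ => F (z + τ • v + τ ^ 2 • w) - F z - τ • fderiv ℝ F z v -
      τ ^ 2 • (fderiv ℝ F z w + (1 / 2 : ℝ) • fderiv ℝ (fderiv ℝ F) z v v)) =o[𝓝 0]
      fun τ => τ ^ 2 := by
  set γ : ℝ → Z := fun τ => z + τ • v + τ ^ 2 • w with hγ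
  have hγ0 : γ 0 = z := by simp [hγ]
  have hγd : ∀ τ, HasDerivAt γ (v + (2 * τ) • w) τ := fun τ => by
    have h1 := ((hasDerivAt_id τ).smul_const v).const_add z
    have h2 := ((hasDerivAt_id τ).pow 2).smul_const w
    have h3 := h1.add h2
    simp only [id, one_smul, Nat.cast_ofNat, Nat.add_one_sub_one, pow_one, mul_one] at h3
    exact h3
  have hγl : Tendsto γ (𝓝 0) (𝓝 z) := by
    have := (hγd 0).continuousAt.tendsto
    rwa [hγ0] at this
  set c : E := fderiv ℝ F z w + (1 / 2 : ℝ) • fderiv ℝ (fderiv ℝ F) z v v with hc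
  set ψ : ℝ → E := fun τ => F (γ τ) - F z - τ • fderiv ℝ F z v - τ ^ 2 • c with hψ
  -- χ is the derivative of ψ. The choice of c makes χ(0) = 0 and χ'(0) = 0, so χ = o(τ) and the
  -- mean value inequality gives ψ = o(τ²).
  set χ : ℝ → E := fun τ => fderiv ℝ F (γ τ) (v + (2 * τ) • w) - fderiv ℝ F z v - (2 * τ) • c
    with hχ
  have hψd : ∀ᶠ τ in 𝓝 (0 : ℝ), HasDerivAt ψ (χ τ) τ := by
    have h1 : ∀ᶠ z' in 𝓝 z, HasFDerivAt F (fderiv ℝ F z') z' :=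
      (hF.eventually (by simp)).mono fun _ h => (h.differentiableAt (by simp)).hasFDerivAt
    filter_upwards [hγl.eventually h1] with τ hτ
    have h2 := (((hτ.comp_hasDerivAt τ (hγd τ)).sub_const (F z)).sub
      ((hasDerivAt_id τ).smul_const (fderiv ℝ F z v))).sub
      (((hasDerivAt_id τ).pow 2).smul_const c)
    simp only [id, one_smul, Nat.cast_ofNat, Nat.add_one_sub_one, pow_one, mul_one] at h2
    exact h2
  have hFd : HasFDerivAt (fderiv ℝ F) (fderiv ℝ (fderiv ℝ F) z) (γ 0) := by
    rw [hγ0]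
    exact ((hF.fderiv_right (m := 1) (by norm_num)).differentiableAt (by simp)).hasFDerivAt
  have hχd : HasDerivAt χ 0 0 := by
    have h1 := hFd.comp_hasDerivAt 0 (hγd 0)
    have h2 : HasDerivAt (fun τ : ℝ => v + (2 * τ) • w) ((2 : ℝ) • w) 0 := by
      have := (((hasDerivAt_id (0 : ℝ)).const_mul 2).smul_const w).const_add v
      simpa using this
    have h3 : HasDerivAt (fun τ : ℝ => (2 * τ) • c) ((2 : ℝ) • c) 0 := by
      have := ((hasDerivAt_id (0 : ℝ)).const_mul 2).smul_const c
      simpa using this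
    have h4 := ((h1.clm_apply h2).sub_const (fderiv ℝ F z v)).sub h3
    have h5 : fderiv ℝ (fderiv ℝ F) z (v + ((2 : ℝ) * 0) • w) (v + ((2 : ℝ) * 0) • w) +
        (fderiv ℝ F ∘ γ) 0 ((2 : ℝ) • w) - (2 : ℝ) • c = 0 := by
      rw [mul_zero, zero_smul, add_zero, Function.comp_apply, hγ0, hc, map_smul, smul_add,
        smul_smul, mul_one_div_cancel two_ne_zero, one_smul, add_comm, sub_self]
    rw [h5] at h4
    exact h4
  have hχ0 : χ 0 = 0 := by simp [hχ, hγ0]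
  have hψ0 : ψ 0 = 0 := by simp [hψ, hγ0]
  rw [Asymptotics.isLittleO_iff]
  intro ε hε
  have h5 := hχd.isLittleO.def hε
  obtain ⟨δ, hδ, hball⟩ := Metric.eventually_nhds_iff.1 (hψd.and h5)
  refine Metric.eventually_nhds_iff.2 ⟨δ, hδ, fun τ hτ => ?_⟩
  have hsub : ∀ τ' ∈ Metric.closedBall (0 : ℝ) |τ|, dist τ' 0 < δ := fun τ' h => by
    refine (Metric.mem_closedBall.1 h).trans_lt ?_
    rwa [dist_zero_right, Real.norm_eq_abs] at hτ
  have h6 := Convex.norm_image_sub_le_of_norm_hasDerivWithin_le (f := ψ) (f' := χ)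
    (s := Metric.closedBall (0 : ℝ) |τ|) (x := 0) (y := τ) (C := ε * |τ|)
    (fun τ' h => (hball (hsub τ' h)).1.hasDerivWithinAt) (fun τ' h => ?_)
    (convex_closedBall _ _) (Metric.mem_closedBall_self (abs_nonneg _)) (by simp)
  · rw [hψ0, sub_zero, sub_zero] at h6
    refine h6.trans_eq ?_
    rw [norm_pow, Real.norm_eq_abs]
    ring
  · have h7 := (hball (hsub τ' h)).2
    simp only [hχ0, sub_zero, smul_zero] at h7
    refine h7.trans (mul_le_mul_of_nonneg_left ?_ hε.le)
    simpa using h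

end Penalization

/-! ### Realizing elements of the graphical derivative -/

section Realization

variable {P X E : Type*} [NormedAddCommGroup P] [NormedSpace ℝ P]
  [NormedAddCommGroup X] [NormedSpace ℝ X] [NormedAddCommGroup E] [NormedSpace ℝ E]

/-- A convex combination of `η` and η₀ + εσ. A shift of order ε towards `η₀` makes room for the ε²
shift by `σ`, even if `η` is on the relative boundary. -/
theorem add_smul_mem_polarCone {K : ProperCone ℝ E} {η₀ η σ : StrongDual ℝ E}
    (hη : η ∈ polarCone K) {ε : ℝ} (h0 : 0 ≤ ε) (h1 : ε ≤ 1)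
    (hσ : η₀ + ε • σ ∈ polarCone K) : η + ε • (η₀ - η) + ε ^ 2 • σ ∈ polarCone K := by
  intro k hk
  have h2 := hη k hk
  have h3 := hσ k hk
  simp only [_root_.add_apply, _root_.smul_apply, _root_.sub_apply, smul_eq_mul] at h3 ⊢
  have : η k + ε * (η₀ k - η k) + ε ^ 2 * σ k = (1 - ε) * η k + ε * (η₀ k + ε * σ k) := by ring
  rw [this]
  exact add_nonpos (mul_nonpos_of_nonneg_of_nonpos (by linarith) h2)
    (mul_nonpos_of_nonneg_of_nonpos h0 h3)

namespace IsConeSystem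

variable {F : P × X → E} {Γ : P → Set X} {K : ProperCone ℝ E} {κ : ℝ} {z : P × X}

/-- Near the reference point, every polar functional is up to a penalty term a multiplier at a
point whose distance to `y` is controlled by the infeasibility of `y`. -/
theorem exists_regularNormal_near [FiniteDimensional ℝ X] (hS : IsConeSystem F Γ K κ z) :
    ∃ c : ℝ, ∃ ρ : ℝ, 0 < ρ ∧ ∃ U ∈ 𝓝 z, ∀ᶠ y in 𝓝 z, ∀ k ∈ K, ‖F y - k‖ ≤ ρ →
      ∀ η ∈ polarCone K, η k = 0 → ∃ x ∈ Γ y.1,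
        ‖toEuclidean (x - y.2)‖ ^ 2 ≤ (c + ‖η‖ * c) * ‖F y - k‖ ∧
        ((y.1, x) ∈ U →
          η.comp ((fderiv ℝ F (y.1, x)).comp (ContinuousLinearMap.inr ℝ P X)) -
            euclideanGradient (x - y.2) ∈ regularNormalCone (Γ y.1) x) := by
  obtain ⟨L, s, hs, hL⟩ := (hS.contDiffAt.of_le (m := 1) (by norm_num)).exists_lipschitzOnWith
  obtain ⟨r, hr, hball⟩ := Metric.nhds_basis_closedBall.mem_iff.1
    (inter_mem hs (hS.eventually_hasFDerivAt.and hS.eventually_mem_iff))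
  have hκ := hS.nonneg
  set e : X →L[ℝ] EuclideanSpace ℝ (Fin (Module.finrank ℝ X)) :=
    (toEuclidean : X ≃L[ℝ] EuclideanSpace ℝ (Fin (Module.finrank ℝ X))).toContinuousLinearMap
    with he
  -- The first term bounds the squared distance from `x'` to `y.2`, using d² ≤ d for d ≤ 1; the rest
  -- bounds ‖F(x') - k‖, which controls -η(F(x')) because `η k = 0`.
  set c : ℝ := ‖e‖ ^ 2 * κ ^ 2 + L * κ + 1 with hc
  refine ⟨c, min 1 (r / 2 / (κ + 1)), by positivity, Metric.ball z r,
    Metric.ball_mem_nhds z hr, ?_⟩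
  filter_upwards [Metric.ball_mem_nhds z (half_pos hr), hS.eventually_exists]
    with y hy hyR k hk hd η hη hηk
  obtain ⟨x', hx', hle⟩ := hyR k hk
  set d : ℝ := ‖F y - k‖ with hd'
  have hd0 : 0 ≤ d := norm_nonneg _
  have hd1 : d ≤ 1 := hd.trans (min_le_left _ _)
  have hd2 : κ * d ≤ r / 2 := by
    have h1 := hd.trans (min_le_right _ _)
    rw [le_div_iff₀ (by positivity)] at h1
    nlinarith
  have hyb : y ∈ Metric.closedBall z r :=
    Metric.ball_subset_closedBall (Metric.ball_subset_ball (by linarith) hy)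
  have hprod : ∀ x, (y.1, x) ∈ Metric.closedBall z r ↔ x ∈ Metric.closedBall z.2 r := fun x => by
    rw [← closedBall_prod_same, Set.mem_prod, and_iff_right]
    exact (le_max_left _ _).trans (Metric.mem_closedBall.1 hyb)
  have hdist : dist (y.1, x') y ≤ κ * d := by
    rw [Prod.dist_eq, dist_self, max_eq_right dist_nonneg, dist_eq_norm]
    exact hle
  have hx'b : (y.1, x') ∈ Metric.closedBall z r := by
    rw [Metric.mem_closedBall]
    have h1 := dist_triangle (y.1, x') y z
    have h2 := Metric.mem_ball.1 hy
    linarith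
  obtain ⟨x, hxb, hxΓ, hxle, hxn⟩ := exists_regularNormal_of_penalty (Γ := Γ y.1)
    (G := fun x => F (y.1, x)) (x₀ := z.2) (r := r)
    (fun x hx => by
      have := (hball ((hprod x).2 hx)).2.1
      exact (this.comp_prodMk_right.continuousAt).continuousWithinAt)
    (fun x hx => (hball ((hprod x).2 hx)).2.2) hη y.2 ((hprod x').1 hx'b) hx'
  refine ⟨x, hxΓ, hxle.trans ?_, fun hxU => ?_⟩
  · have h1 : -η (F (y.1, x')) ≤ ‖η‖ * ((L * κ + 1) * d) := by
      have h2 : η (F (y.1, x')) = η (F (y.1, x') - k) := by rw [map_sub, hηk, sub_zero]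
      rw [h2]
      refine (neg_le_abs _).trans ((η.le_opNorm _).trans
        (mul_le_mul_of_nonneg_left ?_ (norm_nonneg _)))
      have h3 : F (y.1, x') - k = (F (y.1, x') - F y) + (F y - k) := by abel
      have h4 := hL.dist_le_mul _ (hball hx'b).1 _ (hball hyb).1
      rw [dist_eq_norm] at h4
      have h5 : (L : ℝ) * dist (y.1, x') y ≤ L * (κ * d) :=
        mul_le_mul_of_nonneg_left hdist L.2
      rw [h3]
      refine (norm_add_le _ _).trans ?_
      rw [← hd']
      linarith
    have h6 : ‖toEuclidean (x' - y.2)‖ ≤ ‖e‖ * (κ * d) :=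
      (e.le_opNorm _).trans (mul_le_mul_of_nonneg_left hle (norm_nonneg _))
    have h7 : ‖toEuclidean (x' - y.2)‖ ^ 2 ≤ ‖e‖ ^ 2 * κ ^ 2 * d := by
      have h8 := pow_le_pow_left₀ (norm_nonneg _) h6 2
      have h9 : (‖e‖ * (κ * d)) ^ 2 = ‖e‖ ^ 2 * κ ^ 2 * (d * d) := by ring
      rw [h9] at h8
      exact h8.trans (mul_le_mul_of_nonneg_left (mul_le_of_le_one_left hd0 hd1) (by positivity))
    have hL0 : (0 : ℝ) ≤ L := L.2
    have h10 : ‖e‖ ^ 2 * κ ^ 2 * d ≤ c * d := by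
      refine mul_le_mul_of_nonneg_right ?_ hd0
      rw [hc]; nlinarith [mul_nonneg hL0 hκ]
    have h11 : ‖η‖ * ((L * κ + 1) * d) ≤ ‖η‖ * (c * d) := by
      refine mul_le_mul_of_nonneg_left (mul_le_mul_of_nonneg_right ?_ hd0) (norm_nonneg _)
      rw [hc]
      have : 0 ≤ ‖e‖ ^ 2 * κ ^ 2 := by positivity
      linarith
    have h12 : (c + ‖η‖ * c) * d = c * d + ‖η‖ * (c * d) := by ring
    rw [h12]
    linarith
  · have h1 : x ∈ Metric.ball z.2 r := by
      rw [Metric.mem_ball] at hxU ⊢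
      exact (le_max_right _ _).trans_lt hxU
    exact hxn h1 _ (hball (Metric.ball_subset_closedBall hxU)).2.1.comp_prodMk_right

/-- Realization of graphical derivatives along second-order feasible arcs. -/
theorem add_mem_graphicalDerivative [FiniteDimensional ℝ X] (hS : IsConeSystem F Γ K κ z)
    {η₀ η : StrongDual ℝ E} (hη₀ : IsRelInteriorPolar K η₀) (hη : η ∈ polarCone K)
    {xs : StrongDual ℝ X}
    (hη₀A : η₀.comp ((fderiv ℝ F z).comp (ContinuousLinearMap.inr ℝ P X)) = xs)
    (hηA : η.comp ((fderiv ℝ F z).comp (ContinuousLinearMap.inr ℝ P X)) = xs)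
    {v w : P × X} (hv : fderiv ℝ F z v ∈ linealitySpace (K : Set E))
    (hw : fderiv ℝ F z w + (1 / 2 : ℝ) • fderiv ℝ (fderiv ℝ F) z v v ∈
      linealitySpace (K : Set E))
    {s : StrongDual ℝ X}
    (hs : ∀ u, fderiv ℝ F z (0, u) ∈ linealitySpace (K : Set E) → s u = 0) :
    η.comp ((fderiv ℝ (fderiv ℝ F) z v).comp (ContinuousLinearMap.inr ℝ P X)) + s ∈
      graphicalDerivative (fun z' => limitingNormalCone (Γ z'.1) z'.2) z xs v := by
  obtain ⟨σ, hσ, hσA⟩ := exists_span_polarCone_comp_eq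
    ((fderiv ℝ F z).comp (ContinuousLinearMap.inr ℝ P X)) hs
  obtain ⟨c, ρ, hρ, U, hU, hnear⟩ := hS.exists_regularNormal_near
  set ε : ℕ → ℝ := fun n => 1 / ((n : ℝ) + 1) with hεdef
  have hε0 : ∀ n, 0 < ε n := fun n => Nat.one_div_pos_of_nat
  have hε1 : ∀ n, ε n ≤ 1 := fun n => by
    rw [hεdef]
    exact (div_le_one (by positivity)).2 (by linarith [(Nat.cast_nonneg n : (0 : ℝ) ≤ n)])
  have hεl : Tendsto ε atTop (𝓝 0) := tendsto_one_div_add_atTop_nhds_zero_nat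
  -- With t = ε² the pullback of `η'` to X is exactly xs + t s: the order-ε shift along `η₀ - η` is
  -- invisible there.
  set t : ℕ → ℝ := fun n => ε n ^ 2 with htdef
  have ht0 : ∀ n, 0 < t n := fun n => pow_pos (hε0 n) 2
  have htl : Tendsto t atTop (𝓝 0) := by simpa using hεl.pow 2
  set η' : ℕ → StrongDual ℝ E := fun n => η + ε n • (η₀ - η) + t n • σ with hη'def
  have hη'l : Tendsto η' atTop (𝓝 η) := by
    simpa using (tendsto_const_nhds.add (hεl.smul_const (η₀ - η))).add (htl.smul_const σ)
  have hη'K : ∀ᶠ n in atTop, η' n ∈ polarCone K :=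
    (hεl.eventually (hη₀ σ hσ)).mono fun n hn =>
      add_smul_mem_polarCone hη (hε0 n).le (hε1 n) hn
  have hη'A : ∀ n, (η' n).comp ((fderiv ℝ F z).comp (ContinuousLinearMap.inr ℝ P X)) =
      xs + t n • s := fun n => by
    simp only [hη'def, ContinuousLinearMap.add_comp, ContinuousLinearMap.smul_comp,
      ContinuousLinearMap.sub_comp, hη₀A, hηA, hσA, sub_self, smul_zero, add_zero]
  set y : ℕ → P × X := fun n => z + t n • v + t n ^ 2 • w with hydef
  have hyl : Tendsto y atTop (𝓝 z) := by
    simpa using (tendsto_const_nhds (x := z)).add (htl.smul_const v) |>.add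
      ((htl.pow 2).smul_const w)
  -- The second-order expansion of F along the arc. Lying in the lineality space, it is killed by
  -- every polar functional.
  set k : ℕ → E := fun n => t n • fderiv ℝ F z v +
    t n ^ 2 • (fderiv ℝ F z w + (1 / 2 : ℝ) • fderiv ℝ (fderiv ℝ F) z v v) with hkdef
  have hkL : ∀ n, k n ∈ linealitySpace (K : Set E) := fun n =>
    linealitySpace_add (linealitySpace_smul _ hv) (linealitySpace_smul _ hw)
  have hdo : (fun n => ‖F (y n) - k n‖) =o[atTop] fun n => t n ^ 2 := by
    have := ((isLittleO_parabolic_arc hS.contDiffAt v w).comp_tendsto htl).norm_left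
    refine this.congr_left fun n => ?_
    simp only [Function.comp_apply, hydef, hkdef, hS.map_eq_zero, sub_zero]
    rw [sub_sub]
  have hdl : Tendsto (fun n => ‖F (y n) - k n‖ / t n ^ 2) atTop (𝓝 0) :=
    hdo.tendsto_div_nhds_zero
  have hd0 : Tendsto (fun n => ‖F (y n) - k n‖) atTop (𝓝 0) := by
    have h2 : Tendsto (fun n => t n ^ 2) atTop (𝓝 0) := by simpa using htl.pow 2
    exact hdo.trans_tendsto h2
  have hev : ∀ᶠ n in atTop, ∃ x, x ∈ Γ (y n).1 ∧
      ‖toEuclidean (x - (y n).2)‖ ^ 2 ≤ (c + ‖η' n‖ * c) * ‖F (y n) - k n‖ ∧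
      (((y n).1, x) ∈ U →
        (η' n).comp ((fderiv ℝ F ((y n).1, x)).comp (ContinuousLinearMap.inr ℝ P X)) -
          euclideanGradient (x - (y n).2) ∈ regularNormalCone (Γ (y n).1) x) := by
    filter_upwards [hyl.eventually hnear, hη'K, hd0.eventually_le_const hρ] with n h1 h2 h3
    exact h1 _ (mem_linealitySpace.1 (hkL n)).1 h3 _ h2
      (apply_eq_zero_of_mem_linealitySpace h2 (hkL n))
  obtain ⟨x, hx⟩ := hev.choice
  -- Penalization bounds only the square of the correction by the residual, so the residual must be
  -- o(t²) for `b` to tend to 0.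
  set b : ℕ → X := fun n => (t n)⁻¹ • (x n - (y n).2) with hbdef
  have hbl : Tendsto b atTop (𝓝 0) := by
    have h1 : Tendsto (fun n => ‖toEuclidean (b n)‖ ^ 2) atTop (𝓝 0) := by
      have h2 : Tendsto (fun n => (c + ‖η' n‖ * c) * (‖F (y n) - k n‖ / t n ^ 2)) atTop (𝓝 0) := by
        simpa using ((hη'l.norm.mul_const c).const_add c).mul hdl
      refine squeeze_zero' (.of_forall fun _ => by positivity) ?_ h2
      filter_upwards [hx] with n hn
      rw [hbdef, map_smul, norm_smul, mul_pow, norm_inv, Real.norm_of_nonneg (ht0 n).le,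
        ← mul_div_assoc, inv_pow, inv_mul_eq_div]
      exact div_le_div_of_nonneg_right hn.2.1 (by positivity)
    have h3 : Tendsto (fun n => toEuclidean (b n)) atTop (𝓝 0) := by
      rw [tendsto_zero_iff_norm_tendsto_zero]
      have h4 := h1.sqrt
      rw [Real.sqrt_zero] at h4
      exact h4.congr fun n => Real.sqrt_sq (norm_nonneg _)
    have h5 := (toEuclidean.symm.continuous.tendsto
      (0 : EuclideanSpace ℝ (Fin (Module.finrank ℝ X)))).comp h3
    rw [map_zero] at h5
    exact h5.congr fun n => toEuclidean.symm_apply_apply _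
  set v' : ℕ → P × X := fun n => v + t n • w + ContinuousLinearMap.inr ℝ P X (b n) with hv'def
  have hv'l : Tendsto v' atTop (𝓝 v) := by
    have h1 : Tendsto (fun n => ContinuousLinearMap.inr ℝ P X (b n)) atTop (𝓝 0) := by
      have := ((ContinuousLinearMap.inr ℝ P X).continuous.tendsto 0).comp hbl
      rwa [map_zero] at this
    have h2 := ((tendsto_const_nhds (x := v)).add (htl.smul_const w)).add h1
    rwa [zero_smul, add_zero, add_zero] at h2
  have hzv : ∀ n, z + t n • v' n = ((y n).1, x n) := fun n => by
    have h1 : t n • b n = x n - (y n).2 := by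
      rw [hbdef, smul_smul, mul_inv_cancel₀ (ht0 n).ne', one_smul]
    have h2 : z + t n • v' n = y n + ContinuousLinearMap.inr ℝ P X (t n • b n) := by
      simp only [hv'def, hydef, smul_add, map_smul, smul_smul, pow_two]
      abel
    rw [h2, h1]
    ext <;> simp
  have hzl : Tendsto (fun n => z + t n • v' n) atTop (𝓝 z) := tendsto_add_smul htl hv'l
  have hFd : Tendsto (fun n => (t n)⁻¹ • (fderiv ℝ F (z + t n • v' n) - fderiv ℝ F z)) atTop
      (𝓝 (fderiv ℝ (fderiv ℝ F) z v)) :=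
    tendsto_inv_smul_sub hS.hasFDerivAt_fderiv ht0 htl hv'l
  set us : ℕ → StrongDual ℝ X := fun n =>
    (η' n).comp (((t n)⁻¹ • (fderiv ℝ F (z + t n • v' n) - fderiv ℝ F z)).comp
      (ContinuousLinearMap.inr ℝ P X)) + s - euclideanGradient (b n) with husdef
  have husl : Tendsto us atTop
      (𝓝 (η.comp ((fderiv ℝ (fderiv ℝ F) z v).comp (ContinuousLinearMap.inr ℝ P X)) + s)) := by
    have h1 := ((tendsto_clm_comp hη'l (tendsto_clm_comp hFd
      (tendsto_const_nhds (x := ContinuousLinearMap.inr ℝ P X)))).add_const s).sub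
      (tendsto_euclideanGradient hbl)
    rwa [sub_zero] at h1
  refine mem_contingentCone_of_eventually ht0 htl (hv'l.prodMk_nhds husl) ?_
  filter_upwards [hx, hzl.eventually hU] with n hn hnU
  have hgoal : xs + t n • us n =
      (η' n).comp ((fderiv ℝ F ((y n).1, x n)).comp (ContinuousLinearMap.inr ℝ P X)) -
          euclideanGradient (x n - (y n).2) := by
    have h1 : t n • euclideanGradient (b n) = euclideanGradient (x n - (y n).2) := by
      rw [← euclideanGradient_smul, hbdef, smul_smul, mul_inv_cancel₀ (ht0 n).ne', one_smul]
    rw [← hzv, husdef, smul_sub, smul_add, h1, ContinuousLinearMap.smul_comp,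
      ContinuousLinearMap.comp_smul, smul_smul, mul_inv_cancel₀ (ht0 n).ne', one_smul,
      ContinuousLinearMap.sub_comp, ContinuousLinearMap.comp_sub, hη'A]
    abel
  show xs + t n • us n ∈ limitingNormalCone (Γ (z + t n • v' n).1) (z + t n • v' n).2
  rw [hzv] at hnU ⊢
  rw [hgoal]
  exact regularNormalCone_subset_limitingNormalCone _ _ (hn.2.2 hnU)

end IsConeSystem
end Realization

/-! ### Reduction of the constraint system to the cone -/

section Reduction

variable {P X Y E : Type*} [NormedAddCommGroup P] [NormedSpace ℝ P]
  [NormedAddCommGroup X] [NormedSpace ℝ X]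
  [NormedAddCommGroup Y] [NormedSpace ℝ Y] [NormedAddCommGroup E] [NormedSpace ℝ E]

theorem partialX_eq {g : P × X → Y} {z : P × X} (hg : DifferentiableAt ℝ g z) :
    partialX g z = (fderiv ℝ g z).comp (ContinuousLinearMap.inr ℝ P X) :=
  hg.hasFDerivAt.comp_prodMk_right.fderiv

theorem partialP_eq {g : P × X → Y} {z : P × X} (hg : DifferentiableAt ℝ g z) :
    partialP g z = (fderiv ℝ g z).comp (ContinuousLinearMap.inl ℝ P X) :=
  (HasFDerivAt.comp z.1 (g := g) (by exact hg.hasFDerivAt)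
    (hasFDerivAt_prodMk_left z.1 z.2)).fderiv

theorem ContDiffAt.hasFDerivAt_fderiv_of_two {Z : Type*} [NormedAddCommGroup Z] [NormedSpace ℝ Z]
    {g : Z → Y} {z : Z} (hg : ContDiffAt ℝ 2 g z) :
    HasFDerivAt (fderiv ℝ g) (fderiv ℝ (fderiv ℝ g) z) z :=
  ((hg.fderiv_right (m := 1) (by norm_num)).differentiableAt (by simp)).hasFDerivAt

theorem ContDiffAt.eventually_differentiableAt_of_two {Z : Type*} [NormedAddCommGroup Z]
    [NormedSpace ℝ Z] {g : Z → Y} {z : Z} (hg : ContDiffAt ℝ 2 g z) :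
    ∀ᶠ z' in 𝓝 z, DifferentiableAt ℝ g z' :=
  (hg.eventually (by simp)).mono fun _ h => h.differentiableAt (by simp)

/-- The second-order chain rule. -/
theorem fderiv_fderiv_comp_apply {Z : Type*} [NormedAddCommGroup Z] [NormedSpace ℝ Z]
    {g : Z → Y} {h : Y → E} {z : Z} (hg : ContDiffAt ℝ 2 g z) (hh : ContDiffAt ℝ 2 h (g z))
    (v : Z) :
    fderiv ℝ (fderiv ℝ (fun z => h (g z))) z v =
      (fderiv ℝ (fderiv ℝ h) (g z) (fderiv ℝ g z v)).comp (fderiv ℝ g z) +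
        (fderiv ℝ h (g z)).comp (fderiv ℝ (fderiv ℝ g) z v) := by
  have hev : fderiv ℝ (fun z => h (g z)) =ᶠ[𝓝 z]
      fun z' => (fderiv ℝ h (g z')).comp (fderiv ℝ g z') := by
    filter_upwards [hg.eventually_differentiableAt_of_two,
      hg.continuousAt.eventually hh.eventually_differentiableAt_of_two] with z' h1 h2
    exact fderiv_comp z' h2 h1
  have hd := (hh.hasFDerivAt_fderiv_of_two.comp z
    (hg.differentiableAt (by simp)).hasFDerivAt).clm_comp hg.hasFDerivAt_fderiv_of_two
  rw [(hd.congr_of_eventuallyEq hev).fderiv]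
  ext w
  simp [add_comm]

/-- The Lagrangian and the curvature term together are the second derivative of the reduced
system. -/
theorem lagrangianTerm_add_curvatureTerm {g : P × X → Y} {h : Y → E} {z : P × X}
    (hg : ContDiffAt ℝ 2 g z) (hh : ContDiffAt ℝ 2 h (g z))
    (hsurj : Function.Surjective (fderiv ℝ h (g z))) (η : StrongDual ℝ E) (v : P × X) :
    lagrangianTerm g z (η.comp (fderiv ℝ h (g z))) v +
        curvatureTerm g h z (η.comp (fderiv ℝ h (g z))) v =
      η.comp ((fderiv ℝ (fderiv ℝ (fun z => h (g z))) z v).comp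
        (ContinuousLinearMap.inr ℝ P X)) := by
  have hl : lagrangianTerm g z (η.comp (fderiv ℝ h (g z))) v =
      (η.comp (fderiv ℝ h (g z))).comp
        ((fderiv ℝ (fderiv ℝ g) z v).comp (ContinuousLinearMap.inr ℝ P X)) := by
    have hev : (fun z' => (η.comp (fderiv ℝ h (g z))).comp (partialX g z')) =ᶠ[𝓝 z]
        fun z' => (η.comp (fderiv ℝ h (g z))).comp
          ((fderiv ℝ g z').comp (ContinuousLinearMap.inr ℝ P X)) :=
      hg.eventually_differentiableAt_of_two.mono fun z' h1 => by
        simp only [partialX_eq h1]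
    have hd := (hasFDerivAt_const (η.comp (fderiv ℝ h (g z))) z).clm_comp
      (hg.hasFDerivAt_fderiv_of_two.clm_comp
        (hasFDerivAt_const (ContinuousLinearMap.inr ℝ P X) z))
    rw [lagrangianTerm, (hd.congr_of_eventuallyEq hev).fderiv]
    ext u
    simp
  have hc : fderiv ℝ (fderiv ℝ (fun y => η (h y))) (g z) (fderiv ℝ g z v) =
      η.comp (fderiv ℝ (fderiv ℝ h) (g z) (fderiv ℝ g z v)) := by
    have hev : fderiv ℝ (fun y => η (h y)) =ᶠ[𝓝 (g z)] fun y => η.comp (fderiv ℝ h y) :=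
      hh.eventually_differentiableAt_of_two.mono fun y h1 =>
        (η.hasFDerivAt.comp y h1.hasFDerivAt).fderiv
    have hd := (hasFDerivAt_const η (g z)).clm_comp hh.hasFDerivAt_fderiv_of_two
    rw [(hd.congr_of_eventuallyEq hev).fderiv]
    ext u
    simp
  rw [hl, curvatureTerm, adjointInv_comp _ hsurj, hc, fderiv_fderiv_comp_apply hg hh,
    partialX_eq (hg.differentiableAt (by simp))]
  ext u
  simp [add_comm]

/-- A Robinson stable system with a reducible constraint set reduces to a cone system. -/
theorem IsC2Reduction.exists_isConeSystem [FiniteDimensional ℝ Y] [FiniteDimensional ℝ E]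
    {g : P × X → Y} {C : Set Y} {p : P} {x : X} {K : ProperCone ℝ E} {V : Set Y} {h : Y → E}
    (hred : IsC2Reduction C (g (p, x)) K V h) (hg : ContDiffAt ℝ 2 g (p, x))
    (hRS : RobinsonStable g C p x) :
    ∃ κ, IsConeSystem (fun z => h (g z)) (solutionMap g C) K κ (p, x) := by
  obtain ⟨κ, W, hW, U, hU, hRS⟩ := hRS
  obtain ⟨c, hc, hreg⟩ := hred.exists_dist_le
  have hiff : ∀ᶠ z' in 𝓝 (p, x), z'.2 ∈ solutionMap g C z'.1 ↔ h (g z') ∈ K :=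
    hg.continuousAt.eventually hred.eventually_mem_iff
  -- The extra 1 makes the distance bound strict for a positive residual, so a point realizing it
  -- exists although the infimum need not be attained. For zero residual the point itself is
  -- feasible.
  refine ⟨κ * c + 1, ContDiffAt.comp (p, x) hred.contDiffAt hg, hred.map_eq_zero, by positivity,
    hiff, ?_⟩
  filter_upwards [hiff, hg.continuousAt.eventually hreg, prod_mem_nhds hW hU]
    with z' h1 h2 h3 k hk
  rcases (norm_nonneg (h (g z') - k)).eq_or_lt with h0 | hpos
  · have hk' : h (g z') = k := by rw [← sub_eq_zero, ← norm_eq_zero, ← h0]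
    refine ⟨z'.2, h1.2 (hk' ▸ hk), ?_⟩
    rw [sub_self, norm_zero]
    positivity
  · obtain ⟨y, hy, hle⟩ := h2 k hk
    have h4 : Metric.infEDist z'.2 (solutionMap g C z'.1) <
        ENNReal.ofReal ((κ * c + 1) * ‖h (g z') - k‖) := by
      refine (hRS z'.1 h3.1 z'.2 h3.2).trans_lt ?_
      have h5 : Metric.infEDist (g z') C ≤ ENNReal.ofReal (c * ‖h (g z') - k‖) := by
        refine (Metric.infEDist_le_edist_of_mem hy).trans ?_
        rw [edist_dist, dist_comm, dist_eq_norm]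
        exact ENNReal.ofReal_le_ofReal hle
      refine (mul_le_mul_right h5 (κ : ℝ≥0∞)).trans_lt ?_
      rw [← ENNReal.ofReal_coe_nnreal, ← ENNReal.ofReal_mul (NNReal.coe_nonneg κ)]
      refine (ENNReal.ofReal_lt_ofReal_iff (by positivity)).2 ?_
      linarith
    obtain ⟨x', hx', hlt⟩ := Metric.infEDist_lt_iff.1 h4
    refine ⟨x', hx', ?_⟩
    rw [edist_dist, ENNReal.ofReal_lt_ofReal_iff (by positivity), dist_comm, dist_eq_norm] at hlt
    exact hlt.le

/-- Parameters of the characteristic subspace lift to directions mapped into the lineality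
space. -/
theorem exists_map_mem_linealitySpace_of_mem_characteristicSubspace
    {g : P × X → Y} {C : Set Y} {z : P × X} {K : ProperCone ℝ E} {V : Set Y} {h : Y → E}
    (hred : IsC2Reduction C (g z) K V h) (hg : ContDiffAt ℝ 2 g z) {q : P}
    (hq : q ∈ characteristicSubspace g C z) :
    ∃ u : X, fderiv ℝ (fun z => h (g z)) z (q, u) ∈ linealitySpace (K : Set E) := by
  have hgd := hg.differentiableAt (n := 2) (by simp)
  obtain ⟨-, ⟨u, rfl⟩, b, ⟨hb, hb'⟩, hab⟩ := Set.mem_add.1 hq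
  have hT : ∀ w ∈ contingentCone C (g z), fderiv ℝ h (g z) w ∈ K := fun w =>
    map_mem_of_mem_contingentCone hred.hasFDerivAt hred.map_eq_zero
      (hred.eventually_mem_iff.mono fun _ h => h.1)
  refine ⟨-u, ?_⟩
  have hF : fderiv ℝ (fun z => h (g z)) z = (fderiv ℝ h (g z)).comp (fderiv ℝ g z) :=
    fderiv_comp z hred.hasFDerivAt.differentiableAt hgd
  have hgv : fderiv ℝ g z (q, -u) = b := by
    rw [partialX_eq hgd, partialP_eq hgd] at hab
    have h1 : (q, -u) = ContinuousLinearMap.inl ℝ P X q - ContinuousLinearMap.inr ℝ P X u := by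
      ext <;> simp
    rw [h1, map_sub, sub_eq_iff_eq_add, add_comm]
    exact hab.symm
  rw [hF, ContinuousLinearMap.comp_apply, hgv]
  refine mem_linealitySpace.2 ⟨hT b hb, ?_⟩
  rw [← map_neg]
  exact hT _ hb'

end Reduction

/-! ### Assembly of the main theorem -/

theorem mainTheorem5 {P X Y E : Type*}
    [NormedAddCommGroup P] [NormedSpace ℝ P] [FiniteDimensional ℝ P]
    [NormedAddCommGroup X] [NormedSpace ℝ X] [FiniteDimensional ℝ X]
    [NormedAddCommGroup Y] [NormedSpace ℝ Y] [FiniteDimensional ℝ Y]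
    [NormedAddCommGroup E] [NormedSpace ℝ E] [FiniteDimensional ℝ E]
    (g : P × X → Y) (C : Set Y) (pbar : P) (xbar : X) (xs : StrongDual ℝ X)
    (K : ProperCone ℝ E) (V : Set Y) (h : Y → E)
    (hfeas : g (pbar, xbar) ∈ C)
    (hxs : xs ∈ normalConeMap g C (pbar, xbar))
    (hg : ContDiffAt ℝ 2 g (pbar, xbar))
    (hC : IsClosed C)
    (hred : IsC2Reduction C (g (pbar, xbar)) K V h)
    (hRS : RobinsonStable g C pbar xbar)
    (hSC : StrictComplementarity (fun x => g (pbar, x)) C xbar xs) :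
    (∀ v : P × X, v.1 ∈ characteristicSubspace g C (pbar, xbar) →
      graphicalDerivative (normalConeMap g C) (pbar, xbar) xs v ⊆
          derivativeEstimate g C h (pbar, xbar) xs v ∧
        (SecondOrderRangeCondition g h K (pbar, xbar) v →
          graphicalDerivative (normalConeMap g C) (pbar, xbar) xs v =
            derivativeEstimate g C h (pbar, xbar) xs v)) ∧
    (Function.Surjective (fderiv ℝ g (pbar, xbar)) →
      ∀ v : P × X, SecondOrderRangeCondition g h K (pbar, xbar) v) := by
  set z : P × X := (pbar, xbar) with hz
  refine ⟨fun v hv => ?_, fun hsurj v => ?_⟩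
  · obtain ⟨κ, hS⟩ := hred.exists_isConeSystem hg hRS
    have hgd : DifferentiableAt ℝ g z := hg.differentiableAt (by simp)
    have hh : ContDiffAt ℝ 2 h (g z) := hred.contDiffAt
    have hFA : fderiv ℝ (fun z => h (g z)) z = (fderiv ℝ h (g z)).comp (fderiv ℝ g z) :=
      fderiv_comp z hred.hasFDerivAt.differentiableAt hgd
    obtain ⟨μ, hμ, hxsμ⟩ := hSC
    obtain ⟨η₀, hη₀, hη₀μ⟩ := hred.isRelInteriorPolar hμ
    have hη₀A : η₀.comp ((fderiv ℝ (fun z => h (g z)) z).comp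
        (ContinuousLinearMap.inr ℝ P X)) = xs := by
      have h1 : fderiv ℝ (fun x => g (pbar, x)) xbar =
          (fderiv ℝ g z).comp (ContinuousLinearMap.inr ℝ P X) := partialX_eq hgd
      rw [hxsμ, ← hη₀μ, h1, hFA]
      rfl
    obtain ⟨u₀, hu₀⟩ := exists_map_mem_linealitySpace_of_mem_characteristicSubspace hred hg hv
    have hsub : graphicalDerivative (normalConeMap g C) z xs v ⊆
        derivativeEstimate g C h z xs v := by
      intro us hus
      obtain ⟨hvK, η, hη, hηv, hηA, hs⟩ := hS.exists_multiplier_of_mem_graphicalDerivative hus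
      have hvL := map_mem_linealitySpace_of_critical hη₀ hη (hηA.trans hη₀A.symm) hu₀ hvK hηv
      obtain ⟨ζ, hζA, hζle, hζ0⟩ := exists_polar_extension hη₀ hη (hηA.trans hη₀A.symm) hs
      have hvT := hS.mem_contingentCone_iff.2 hvK
      refine ⟨η.comp (fderiv ℝ (fun z => h (g z)) z), ?_, hηA, η.comp (fderiv ℝ h (g z)), ⟨?_, ?_⟩,
        ζ.comp (fderiv ℝ (fun z => h (g z)) z), ?_, ?_⟩
      · exact mem_limitingNormalCone_of_le hvT
          (fun w hw => hη _ (hS.mem_contingentCone_iff.1 hw)) hηv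
      · rw [hred.limitingNormalCone_eq]
        exact ⟨η, hη, rfl⟩
      · rw [hFA]
        rfl
      · exact mem_limitingNormalCone_of_le
          (Ω := criticalCone (graphOf (solutionMap g C)) z
            (η.comp (fderiv ℝ (fun z => h (g z)) z))) (And.intro hvT hηv)
          (fun w hw => hζle _ (hS.mem_contingentCone_iff.1 hw.1) hw.2) (hζ0 _ hvL)
      · rw [lagrangianTerm_add_curvatureTerm hg hh hred.surjective]
        have h1 : projXDual (ζ.comp (fderiv ℝ (fun z => h (g z)) z)) =
          us - η.comp ((fderiv ℝ (fderiv ℝ (fun z => h (g z))) z v).comp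
            (ContinuousLinearMap.inr ℝ P X)) := hζA
        rw [h1, add_sub_cancel]
    refine ⟨hsub, fun hSO => hsub.antisymm ?_⟩
    rintro us ⟨zs, hzs, hzx, l, ⟨hl, hlz⟩, ws, hws, rfl⟩
    rw [hred.limitingNormalCone_eq] at hl
    obtain ⟨η, hη, rfl⟩ := hl
    have hηz : η.comp (fderiv ℝ (fun z => h (g z)) z) = zs := by
      rw [← hlz, hFA]
      rfl
    have hηA : η.comp ((fderiv ℝ (fun z => h (g z)) z).comp
        (ContinuousLinearMap.inr ℝ P X)) = xs := by
      rw [← hzx, ← hηz]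
      rfl
    have hvK := hS.mem_contingentCone_iff.1 hzs.1
    -- That `v` is critical is implicit in the existence of a normal `ws` at `v`.
    have hηv : η (fderiv ℝ (fun z => h (g z)) z v) = 0 := by
      have h1 : zs v = 0 := hws.1.2
      rw [← hηz] at h1
      exact h1
    have hvL := map_mem_linealitySpace_of_critical hη₀ hη (hηA.trans hη₀A.symm) hu₀ hvK hηv
    obtain ⟨w, hw⟩ : ∃ w, fderiv ℝ (fun z => h (g z)) z w +
        (1 / 2 : ℝ) • fderiv ℝ (fderiv ℝ (fun z => h (g z))) z v v ∈
          linealitySpace (K : Set E) := by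
      obtain ⟨-, ⟨a, rfl⟩, b, hb, hab⟩ := Set.mem_add.1 hSO
      -- If ∇²F(v,v) = A a + b with b in the lineality space, then w = -a/2 leaves just b/2.
      refine ⟨-((1 / 2 : ℝ) • a), ?_⟩
      have h1 : fderiv ℝ (fderiv ℝ (fun z => h (g z))) z v v =
          fderiv ℝ (fun z => h (g z)) z a + b := by
        rw [fderiv_fderiv_comp_apply hg hh, hFA]
        refine Eq.trans ?_ hab.symm
        exact add_comm _ _
      rw [h1, map_neg, map_smul, smul_add, neg_add_cancel_left]
      exact linealitySpace_smul _ hb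
    rw [lagrangianTerm_add_curvatureTerm hg hh hred.surjective]
    refine hS.add_mem_graphicalDerivative hη₀ hη hη₀A hηA hvL hw fun u hu => ?_
    -- The critical cone is invariant under translation by (0,u), because both K and `η` ignore
    -- shifts along the lineality space.
    refine apply_eq_zero_of_mem_limitingNormalCone
      (Ω := criticalCone (graphOf (solutionMap g C)) z zs)
      (d := ContinuousLinearMap.inr ℝ P X u) (fun w hw τ => And.intro ?_ ?_) hws
    · refine hS.mem_contingentCone_iff.2 ?_
      rw [map_add, map_smul]
      exact K.add_mem (hS.mem_contingentCone_iff.1 hw.1)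
        (mem_linealitySpace.1 (linealitySpace_smul τ hu)).1
    · have h1 : zs w = 0 := hw.2
      have h2 : zs (0, u) = 0 := by
        rw [← hηz]
        exact apply_eq_zero_of_mem_linealitySpace hη hu
      show zs (w + τ • (0, u)) = 0
      rw [map_add, map_smul, h1, h2, smul_zero, add_zero]
  · obtain ⟨w, hw⟩ := (hred.surjective.comp hsurj)
      (fderiv ℝ h (g z) (fderiv ℝ (fderiv ℝ g) z v v) +
        fderiv ℝ (fderiv ℝ h) (g z) (fderiv ℝ g z v) (fderiv ℝ g z v))
    refine Set.mem_add.2 ⟨_, ⟨w, hw⟩, 0, ?_, add_zero _⟩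
    exact mem_linealitySpace.2 ⟨K.zero_mem, by rw [neg_zero]; exact K.zero_mem⟩
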